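/- Let $G=(V,E)$ be a graph with $n$ nodes, maximum degree $\Delta$ and arboricity at most $\alpha$, where $\alpha \ge 2$ is an integer; the arboricity is the minimum number of forests into which the edges can be partitioned. Each node $v$ has a positive integer weight $w_v$ and a unique identifier (a natural number), and weights and identifiers are at most $n^c$ for some constant $c$. In the $\mathsf{CONGEST}$ model the nodes of $G$ communicate in synchronous rounds, in each of which every node may send a message of $O(\log n)$ bits to each of its neighbors; local computation is unrestricted and nodes have private randomness. Initially each node knows only its own identifier and weight, the identifiers of its neighbors, and the parameters of the algorithm ($\Delta$, $\alpha$ and $t$); at the end each node knows whether it belongs to the constructed set. A set $D\subseteq V$ is dominating if every node is in $D$ or has a neighbor in $D$, and $\mathrm{OPT}$ is the minimum of $w(D)=\sum_{v\in D} w_v$ over dominating sets $D$. **Theorem.** For every real $t$ with $1 \le t \le \frac{\alpha}{\log\alpha}$ there is a randomized $\mathsf{CONGEST}$ algorithm that runs in $O(t\log\Delta)$ rounds and, on every such weighted graph, always outputs a dominating set $D$, with $$\mathbb{E}[w(D)] \le \left(\alpha + O\!\left(\tfrac{\alpha}{t}\right)\right)\cdot \mathrm{OPT}.$$ In particular, there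 is such an algorithm with $\mathbb{E}[w(D)] \le (\alpha+O(\log\alpha))\cdot\mathrm{OPT}$ that runs in $O(\alpha\log\Delta)$ rounds. The constants hidden in the bounds on the number of rounds and on the approximation factor are absolute, and the constant in the message size depends only on $c$. In the round bounds, $\log\Delta$ is read as $\log 2$ if $\Delta\le 1$. -/

import Mathlib

/-! ## Arboricity and dominating sets -/

/-- The edges of `G` can be partitioned into `k` forests. -/
def HasForestPartition {V : Type} (G : SimpleGraph V) (k : ℕ) : Prop :=
  ∃ F : Fin k → SimpleGraph V,
    (∀ i, (F i).IsAcyclic) ∧ (Pairwise fun i j => Disjoint (F i) (F j)) ∧ (⨆ i, F i) = G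

/-- The arboricity of `G`: the minimum number of forests into which the edges of `G` can be
partitioned (`⊤` if there is no such finite number, which is impossible for a finite graph). -/
noncomputable def arboricity {V : Type} (G : SimpleGraph V) : ℕ∞ :=
  ⨅ (k : ℕ) (_ : HasForestPartition G k), (k : ℕ∞)

/-- Every node is in `D` or has a neighbor in `D`. -/
def IsDominatingSet {V : Type} (G : SimpleGraph V) (D : Finset V) : Prop :=
  ∀ v, v ∈ D ∨ ∃ u ∈ D, G.Adj v u

/-- A network: a graph whose nodes carry distinct identifiers and positive integer weights. -/
structure Network (V : Type) where
  graph : SimpleGraph V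
  ident : V → ℕ
  ident_injective : Function.Injective ident
  weight : V → ℕ
  weight_pos : ∀ v, 0 < weight v

namespace Network

variable {V : Type}

/-- Identifiers and weights are bounded by `n ^ c`, where `n` is the number of nodes. -/
def PolyBounded [Fintype V] (N : Network V) (c : ℕ) : Prop :=
  ∀ v, N.ident v ≤ Fintype.card V ^ c ∧ N.weight v ≤ Fintype.card V ^ c

/-- The total weight of a set of nodes. -/
def weightOf (N : Network V) (D : Finset V) : ℕ := ∑ v ∈ D, N.weight v

/-- The minimum weight of a dominating set. -/
noncomputable def opt (N : Network V) : ℕ :=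
  sInf {W : ℕ | ∃ D : Finset V, IsDominatingSet N.graph D ∧ N.weightOf D = W}

open Classical in
/-- The maximum degree of the network. -/
noncomputable def maxDegree [Fintype V] (N : Network V) : ℕ := N.graph.maxDegree

open Classical in
/-- The identifiers of the neighbors of `v`. -/
noncomputable def neighborIdents [Fintype V] (N : Network V) (v : V) : Finset ℕ :=
  (N.graph.neighborFinset v).image N.ident

end Network

/-! ## Independent choices -/

theorem tsum_pi_fin_prod {S : Type} (n : ℕ) (p : Fin n → PMF S) :
    ∑' f : Fin n → S, ∏ i, p i (f i) = 1 := by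
  induction n with
  | zero => simp
  | succ n ih =>
    rw [← (Fin.consEquiv fun _ : Fin (n + 1) => S).tsum_eq, ENNReal.tsum_prod']
    simp only [Fin.consEquiv, Equiv.coe_fn_mk, Fin.prod_univ_succ, Fin.cons_zero, Fin.cons_succ,
      ENNReal.tsum_mul_left]
    simp [ih fun i => p i.succ, (p 0).tsum_coe]

theorem tsum_pi_prod {V S : Type} [Fintype V] (p : V → PMF S) :
    ∑' f : V → S, ∏ v, p v (f v) = 1 := by
  let e := Fintype.equivFin V
  rw [← (Equiv.arrowCongr e.symm (Equiv.refl S)).tsum_eq,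
    ← tsum_pi_fin_prod _ fun i => p (e.symm i)]
  refine tsum_congr fun f => ?_
  rw [← e.symm.prod_comp]
  simp

/-- The joint law of independent random choices, one for each `v`, where the choice of `v` has
law `p v`. -/
noncomputable def independentChoices {V S : Type} [Fintype V] (p : V → PMF S) : PMF (V → S) :=
  ⟨fun f => ∏ v, p v (f v), by
    have h := ENNReal.summable.hasSum (f := fun f : V → S => ∏ v, p v (f v))
    rwa [tsum_pi_prod p] at h⟩

/-! ## The randomized CONGEST model -/

/-- What a node knows at the beginning: its identifier, its weight and its set of neighbors. -/
structure LocalInput where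
  ident : ℕ
  weight : ℕ
  neighbors : Finset ℕ

/-- A randomized synchronous message passing algorithm. All nodes run the same program; local
computation is unrestricted, and every node has its own private source of randomness.

* `rounds` is the number of communication rounds;
* `init` is the law of the initial state of a node;
* `send s j` is the bit string that a node in state `s` sends to its neighbor with identifier `j`
  (the empty string if nothing is sent);
* `step s m` is the law of the next state of a node in state `s` that receives the bit string `m j`
  from its neighbor with identifier `j`;
* `output s` says whether a node with final state `s` is in the constructed set. -/
structure DistributedAlgorithm where
  State : Type
  rounds : ℕ
  init : LocalInput → PMF State
  send : State → ℕ → List Bool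
  step : State → (ℕ → List Bool) → PMF State
  output : State → Bool

namespace DistributedAlgorithm

variable {V : Type} [Fintype V]

/-- The initial knowledge of node `v`. -/
noncomputable def localInput (N : Network V) (v : V) : LocalInput where
  ident := N.ident v
  weight := N.weight v
  neighbors := N.neighborIdents v

open Classical in
/-- The messages that node `v` receives, indexed by the identifier of the sender, when the states
of the nodes are given by `s`. -/
noncomputable def inbox (A : DistributedAlgorithm) (N : Network V) (s : V → A.State) (v : V) :
    ℕ → List Bool :=
  Function.extend N.ident
    (fun u => if N.graph.Adj u v then A.send (s u) (N.ident v) else []) (fun _ => [])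

/-- The law of the states of all nodes after `k` rounds. -/
noncomputable def stateLaw (A : DistributedAlgorithm) (N : Network V) : ℕ → PMF (V → A.State)
  | 0 => independentChoices fun v => A.init (localInput N v)
  | k + 1 => (A.stateLaw N k).bind fun s =>
      independentChoices fun v => A.step (s v) (A.inbox N s v)

/-- The law of the set of nodes that the algorithm constructs. -/
noncomputable def outputLaw (A : DistributedAlgorithm) (N : Network V) : PMF (Finset V) :=
  (A.stateLaw N A.rounds).map fun s => Finset.univ.filter fun v => A.output (s v) = true

/-- The expected weight of the constructed set. -/
noncomputable def expectedWeight (A : DistributedAlgorithm) (N : Network V) : ℝ :=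
  ∑ D : Finset V, (A.outputLaw N D).toReal * (N.weightOf D : ℝ)

/-- In every possible execution, every message has at most `b` bits. -/
def MessageBitsAtMost (A : DistributedAlgorithm) (N : Network V) (b : ℝ) : Prop :=
  ∀ k < A.rounds, ∀ s ∈ (A.stateLaw N k).support, ∀ u v, N.graph.Adj u v →
    ((A.send (s u) (N.ident v)).length : ℝ) ≤ b

/-- `A` is a randomized algorithm in the CONGEST model that, on all networks with arboricity at
most `α` and maximum degree `Δ`, always constructs a dominating set, of expected weight at most
`ρ` times the minimum. If the identifiers and weights of the `n`-node network are bounded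
by `n ^ c`, then messages have at most `B c * log n` bits. -/
def ApproximatesMDS (A : DistributedAlgorithm) (B : ℕ → ℝ) (α Δ : ℕ) (ρ : ℝ) : Prop :=
  ∀ (V : Type) [Fintype V] (N : Network V) (c : ℕ),
    N.PolyBounded c → arboricity N.graph ≤ (α : ℕ∞) → N.maxDegree = Δ →
      A.MessageBitsAtMost N (B c * Real.log (Fintype.card V)) ∧
      (∀ D ∈ (A.outputLaw N).support, IsDominatingSet N.graph D) ∧
      A.expectedWeight N ≤ ρ * N.opt

end DistributedAlgorithm

/-! The proof is a primal-dual argument. A packing assigns values `x v ≥ 0` whose sum over each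
closed neighborhood is at most the weight of its center; its total is at most OPT
(`Network.sum_le_opt`). Values start as a small multiple of `minWeight` and grow only at undominated
nodes.

Deterministic stage. A node joins once its load times `1 + ε` reaches its weight. This preserves
feasibility and makes the packing almost tight at joined nodes (`IsTightPacking.update`). The stage
stops when undominated values equal `l * minWeight`, with `l * (α + 1) = ε`. Orient the edges along
at most `α` forests: the node itself and its parents contribute at most `ε` times its weight to its
load, and all contributions of children together are at most `α` times the packing
(`Network.sum_load_le`). Hence the joined weight `W` satisfies `W ≤ (1 + ε) * (ε * W + α * OPT)`,
which gives `α * (1 + 4 * ε) * OPT`; with `ε = 1 / (4 * t)` the excess is `α / t` times OPT.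

Sampling stage. The remaining values are raised by a factor `γ` per phase until they exceed
`minWeight`, when feasibility leaves nobody undominated. Before each raise the nodes whose load
times `γ` reaches their weight must be covered cheaply: they join with probability `1 / (Δ + 1)`,
then `γ` times that, and so on up to `1`. If `v` has `d` candidates in its closed neighborhood,
sampling with probability `p` costs at most `γ * x v * p * d` charged to `v`, while `v` stays
undominated with probability at most `exp (-p * d)`. Since `(p * d + 1) * exp (-p * d) ≤ 1`, a
potential bounds a whole phase by `γ * (γ + 1) * OPT` (`sum_coinsProb_mul_le_potential`,
`expect_samplingPhase_le_add_opt`).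

Taking `γ` constant for large `t` and of order `α ^ (1/4)` for small `t` fits both bounds
(`exists_samplingStage_params`). In the network, values evolve by a rule depending only on
domination bits, so neighbors can track them without transmitting reals (`roundsLaw_ready`). -/

/-! ### Forests as parent maps. -/

open Classical in
/-- Edges of a forest are oriented towards the roots of its components. -/
theorem SimpleGraph.IsAcyclic.exists_parent {V : Type} {G : SimpleGraph V} (h : G.IsAcyclic) :
    ∃ f : V → V, ∀ u v, G.Adj u v → f u = v ∨ f v = u := by
  obtain ⟨r, hr'⟩ : ∃ r : G.ConnectedComponent → V, ∀ c, G.connectedComponentMk (r c) = c :=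
    ⟨fun c => c.exists_rep.choose, fun c => c.exists_rep.choose_spec⟩
  have hr : ∀ v, G.Reachable v (r (G.connectedComponentMk v)) := fun v =>
    SimpleGraph.ConnectedComponent.exact (hr' _).symm
  choose p hp using fun v => (hr v).exists_isPath
  refine ⟨fun v => (p v).snd, fun u v huv => ?_⟩
  -- If the path from `v` to the root passes through `u`, then `u` is its second node. Otherwise
  -- prepending `u` gives a path, by uniqueness the one chosen for `u`, so its second node is `v`.
  by_cases hu : u ∈ (p v).support
  · exact Or.inr (h.eq_snd_of_adj_start (hp v) huv.symm hu).symm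
  · left
    have hc : G.connectedComponentMk v = G.connectedComponentMk u :=
      SimpleGraph.ConnectedComponent.sound huv.symm.reachable
    -- The component is generalized because the endpoints of the two paths are equal only
    -- propositionally.
    have key : ∀ (c : G.ConnectedComponent) (hc : c = G.connectedComponentMk u)
        (q : G.Walk v (r c)), q.IsPath → u ∉ q.support → (p u).snd = v := by
      rintro c rfl q hq hqu
      have := (h.subsingleton_path u _).elim ⟨p u, hp u⟩ ⟨.cons huv q, hq.cons hqu⟩
      simpa using congrArg (fun p => p.1.snd) this
    exact key _ hc (p v) (hp v) hu

theorem exists_parents_of_arboricity_le {V : Type} {G : SimpleGraph V} {α : ℕ}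
    (h : arboricity G ≤ (α : ℕ∞)) :
    ∃ k ≤ α, ∃ F : Fin k → V → V, ∀ u v, G.Adj u v → ∃ i, F i u = v ∨ F i v = u := by
  obtain ⟨k, hk, F, hF, -, rfl⟩ : ∃ k ≤ α, HasForestPartition G k := by
    by_contra! hcon
    have : ((α + 1 : ℕ) : ℕ∞) ≤ arboricity G :=
      le_iInf₂ fun k hk => by
        have : ¬ k ≤ α := fun hle => hcon k hle hk
        exact_mod_cast (by omega : α + 1 ≤ k)
    have h2 := this.trans h
    norm_cast at h2
    omega
  choose f hf using fun i => (hF i).exists_parent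
  refine ⟨k, hk, f, fun u v huv => ?_⟩
  obtain ⟨i, hi⟩ := SimpleGraph.iSup_adj.1 huv
  exact ⟨i, hf i u v hi⟩

/-! ### Closed neighborhoods, duality and charging. -/

namespace Network

variable {V : Type} [Fintype V] (N : Network V)

open Classical in
/-- A node together with its neighbors. -/
noncomputable def closedNbhd (v : V) : Finset V := insert v (N.graph.neighborFinset v)

theorem mem_closedNbhd {u v : V} : u ∈ N.closedNbhd v ↔ u = v ∨ N.graph.Adj v u := by
  simp [closedNbhd]

theorem self_mem_closedNbhd (v : V) : v ∈ N.closedNbhd v := by simp [closedNbhd]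

theorem mem_closedNbhd_comm {u v : V} : u ∈ N.closedNbhd v ↔ v ∈ N.closedNbhd u := by
  rw [mem_closedNbhd, mem_closedNbhd, eq_comm, N.graph.adj_comm]

theorem card_closedNbhd_le (v : V) : (N.closedNbhd v).card ≤ N.maxDegree + 1 := by
  classical
  refine (Finset.card_insert_le _ _).trans (Nat.add_le_add_right ?_ 1)
  rw [SimpleGraph.card_neighborFinset_eq_degree]
  unfold maxDegree
  convert N.graph.degree_le_maxDegree v

open Classical in
theorem sum_closedNbhd (f : V → ℝ) (v : V) :
    ∑ u ∈ N.closedNbhd v, f u = f v + ∑ u ∈ N.graph.neighborFinset v, f u := by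
  rw [closedNbhd, Finset.sum_insert (by simp)]

-- Double counting, by symmetry of closed neighborhoods. It serves both weak duality and the
-- charging of sampled candidates to the nodes they can dominate.
open Classical in
theorem sum_sum_closedNbhd (S T : Finset V) (f : V → ℝ) (g : V → ℝ) :
    ∑ u ∈ S, g u * ∑ v ∈ N.closedNbhd u with v ∈ T, f v
      = ∑ v ∈ T, f v * ∑ u ∈ N.closedNbhd v with u ∈ S, g u := by
  simp only [Finset.mul_sum]
  rw [Finset.sum_comm' (t' := T) (s' := fun v => {u ∈ N.closedNbhd v | u ∈ S})]
  · simp only [mul_comm]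
  · intro u v
    simp only [Finset.mem_filter]
    rw [mem_closedNbhd_comm]
    tauto

open Classical in
/-- The minimum weight in the closed neighborhood of `v`. -/
noncomputable def minWeight (v : V) : ℕ :=
  (N.graph.neighborFinset v).fold min (N.weight v) N.weight

theorem minWeight_le {u v : V} (h : u ∈ N.closedNbhd v) : N.minWeight v ≤ N.weight u := by
  rw [minWeight, Finset.fold_min_le]
  rcases (N.mem_closedNbhd).1 h with rfl | h
  · exact Or.inl le_rfl
  · exact Or.inr ⟨u, by simpa using h, le_rfl⟩

theorem exists_weight_eq_minWeight (v : V) :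
    ∃ u ∈ N.closedNbhd v, N.weight u = N.minWeight v := by
  rcases (Finset.fold_min_le _).1 (le_refl (N.minWeight v)) with h | ⟨u, hu, h⟩
  · exact ⟨v, N.self_mem_closedNbhd v, le_antisymm h (N.minWeight_le (N.self_mem_closedNbhd v))⟩
  · have hu' : u ∈ N.closedNbhd v := N.mem_closedNbhd.2 (Or.inr (by simpa using hu))
    exact ⟨u, hu', le_antisymm h (N.minWeight_le hu')⟩

theorem minWeight_pos (v : V) : 0 < N.minWeight v := by
  obtain ⟨u, -, h⟩ := N.exists_weight_eq_minWeight v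
  exact h ▸ N.weight_pos u

theorem exists_weightOf_eq_opt : ∃ D, IsDominatingSet N.graph D ∧ N.weightOf D = N.opt := by
  exact Nat.sInf_mem (s := {W | ∃ D : Finset V, IsDominatingSet N.graph D ∧ N.weightOf D = W})
    ⟨_, Finset.univ, fun v => Or.inl (Finset.mem_univ v), rfl⟩

open Classical in
/-- Weak duality: a fractional packing is at most the weight of any dominating set. -/
theorem sum_le_opt {x : V → ℝ} {T : Finset V} (hx : ∀ v ∈ T, 0 ≤ x v)
    (h : ∀ u, ∑ v ∈ N.closedNbhd u with v ∈ T, x v ≤ N.weight u) :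
    ∑ v ∈ T, x v ≤ N.opt := by
  obtain ⟨D, hD, hw⟩ := N.exists_weightOf_eq_opt
  calc ∑ v ∈ T, x v ≤ ∑ v ∈ T, x v * ∑ u ∈ N.closedNbhd v with u ∈ D, (1 : ℝ) := by
        refine Finset.sum_le_sum fun v hv => le_mul_of_one_le_right (hx v hv) ?_
        simp only [Finset.sum_const, nsmul_eq_mul, mul_one, Nat.one_le_cast]
        refine Finset.card_pos.2 ?_
        rcases hD v with h | ⟨u, hu, h⟩
        · exact ⟨v, by simp [h, N.self_mem_closedNbhd]⟩
        · exact ⟨u, by simp [hu, N.mem_closedNbhd, h]⟩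
    _ = ∑ u ∈ D, ∑ v ∈ N.closedNbhd u with v ∈ T, x v := by
        rw [← N.sum_sum_closedNbhd]; simp
    _ ≤ ∑ u ∈ D, (N.weight u : ℝ) := Finset.sum_le_sum fun u _ => h u
    _ = N.opt := by rw [← hw, weightOf]; push_cast; rfl

/-- Every value is charged at most once per forest to its parent; the remaining charges are values
of the closed neighborhood that are small compared to the weight. -/
theorem sum_load_le {α : ℕ} (hα : arboricity N.graph ≤ (α : ℕ∞)) {x : V → ℝ} {l : ℝ}
    (hl : 0 ≤ l) (hx : ∀ v, 0 ≤ x v) (hxw : ∀ u, ∀ v ∈ N.closedNbhd u, x v ≤ l * N.weight u)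
    (S : Finset V) :
    ∑ u ∈ S, ∑ v ∈ N.closedNbhd u, x v ≤ (α + 1) * l * N.weightOf S + α * ∑ v, x v := by
  classical
  obtain ⟨k, hk, F, hF⟩ := exists_parents_of_arboricity_le hα
  have hk' : (k : ℝ) ≤ α := by exact_mod_cast hk
  have hsx : 0 ≤ ∑ v, x v := Finset.sum_nonneg fun v _ => hx v
  have h1 : ∀ u, ∑ v ∈ N.closedNbhd u, x v
      ≤ (α + 1) * l * N.weight u + ∑ i, ∑ v, if F i v = u then x v else 0 := by
    intro u
    have hw : 0 ≤ l * N.weight u := by positivity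
    calc ∑ v ∈ N.closedNbhd u, x v
        -- Each `v` here is `u` itself, a parent of `u` or a child of `u` in some forest.
        ≤ ∑ v ∈ N.closedNbhd u, ((if u = v then x v else 0)
            + ∑ i, ((if F i u = v then x v else 0) + if F i v = u then x v else 0)) := by
          refine Finset.sum_le_sum fun v hv => ?_
          have hnn : ∀ i, 0 ≤ (if F i u = v then x v else 0) + if F i v = u then x v else 0 := by
            intro i
            have := hx v
            split_ifs <;> linarith
          rcases N.mem_closedNbhd.1 hv with rfl | h
          · have := Finset.sum_nonneg fun i (_ : i ∈ Finset.univ) => hnn i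
            simpa using this
          · obtain ⟨i, hi⟩ := hF u v h
            have h2 := Finset.single_le_sum (fun j _ => hnn j) (Finset.mem_univ i)
            have h3 : x v ≤ (if F i u = v then x v else 0) + if F i v = u then x v else 0 := by
              have := hx v
              rcases hi with hi | hi <;> simp only [hi, if_true] <;> split_ifs <;> linarith
            have h4 : 0 ≤ if u = v then x v else 0 := by
              have := hx v
              split_ifs <;> linarith
            linarith
      _ = (∑ v ∈ N.closedNbhd u, (if u = v then x v else 0))
            + (∑ i, ∑ v ∈ N.closedNbhd u, (if F i u = v then x v else 0)
            + ∑ i, ∑ v ∈ N.closedNbhd u, (if F i v = u then x v else 0)) := by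
          rw [Finset.sum_add_distrib, Finset.sum_comm, ← Finset.sum_add_distrib]
          simp only [Finset.sum_add_distrib]
      _ ≤ l * N.weight u + (k * (l * N.weight u)
            + ∑ i, ∑ v, if F i v = u then x v else 0) := by
          have h5 : ∀ a, ∑ v ∈ N.closedNbhd u, (if a = v then x v else 0) ≤ l * N.weight u := by
            intro a
            rw [Finset.sum_ite_eq]
            split_ifs with ha
            · exact hxw u a ha
            · exact hw
          gcongr with i
          · exact h5 u
          · calc _ ≤ ∑ i : Fin k, l * N.weight u := Finset.sum_le_sum fun i _ => h5 _
              _ = _ := by simp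
          · intro v _ _
            have := hx v
            split_ifs <;> linarith
          · exact Finset.subset_univ _
      _ ≤ _ := by nlinarith
  calc _ ≤ ∑ u ∈ S, ((α + 1) * l * N.weight u + ∑ i, ∑ v, if F i v = u then x v else 0) :=
        Finset.sum_le_sum fun u _ => h1 u
    _ = (α + 1) * l * N.weightOf S + ∑ i, ∑ v, ∑ u ∈ S, if F i v = u then x v else 0 := by
        rw [Finset.sum_add_distrib, Finset.sum_comm]
        congr 1
        · rw [← Finset.mul_sum, weightOf]; push_cast; rfl
        · exact Finset.sum_congr rfl fun i _ => Finset.sum_comm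
    _ ≤ (α + 1) * l * N.weightOf S + ∑ i : Fin k, ∑ v, x v := by
        -- In each forest `v` has a single parent, so it is charged at most once.
        gcongr with i _ v
        rw [Finset.sum_ite_eq]
        have := hx v
        split_ifs <;> linarith
    _ ≤ _ := by
        simp only [Finset.sum_const, Finset.card_univ, Fintype.card_fin, nsmul_eq_mul]
        gcongr

end Network

/-! ### Expectations and independent coins. -/

namespace PMF

open ENNReal

/-- The expectation of `g` under the law `μ`. -/
noncomputable def expect {σ : Type} (μ : PMF σ) (g : σ → ℝ≥0∞) : ℝ≥0∞ := ∑' a, μ a * g a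

variable {σ τ : Type}

theorem expect_pure (a : σ) (g : σ → ℝ≥0∞) : (PMF.pure a).expect g = g a := by
  classical
  rw [expect, tsum_eq_single a]
  · simp
  · intro b hb
    simp [PMF.pure_apply, hb]

theorem expect_bind (μ : PMF σ) (f : σ → PMF τ) (g : τ → ℝ≥0∞) :
    (μ.bind f).expect g = μ.expect fun a => (f a).expect g := by
  simp only [expect, PMF.bind_apply, ← ENNReal.tsum_mul_right, ← ENNReal.tsum_mul_left]
  rw [ENNReal.tsum_comm]
  simp only [mul_assoc]

theorem expect_map (μ : PMF σ) (f : σ → τ) (g : τ → ℝ≥0∞) :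
    (μ.map f).expect g = μ.expect fun a => g (f a) := by
  rw [← PMF.bind_pure_comp, expect_bind]
  simp [expect_pure]

theorem expect_add_const (μ : PMF σ) (g : σ → ℝ≥0∞) (c : ℝ≥0∞) :
    (μ.expect fun a => g a + c) = μ.expect g + c := by
  simp only [expect, mul_add]
  rw [ENNReal.tsum_add, ENNReal.tsum_mul_right, PMF.tsum_coe, one_mul]

theorem expect_mono_of_support (μ : PMF σ) {g h : σ → ℝ≥0∞} (hgh : ∀ a ∈ μ.support, g a ≤ h a) :
    μ.expect g ≤ μ.expect h := by
  refine ENNReal.tsum_le_tsum fun a => ?_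
  by_cases ha : μ a = 0
  · simp [ha]
  · gcongr
    exact hgh a ((PMF.mem_support_iff _ _).2 ha)

theorem expect_le_of_support (μ : PMF σ) {g : σ → ℝ≥0∞} {c : ℝ≥0∞}
    (hg : ∀ a ∈ μ.support, g a ≤ c) : μ.expect g ≤ c := by
  refine (μ.expect_mono_of_support hg).trans ?_
  rw [expect, ENNReal.tsum_mul_right, PMF.tsum_coe, one_mul]

end PMF

section independentChoices

variable {V S T : Type} [Fintype V]

theorem independentChoices_apply (p : V → PMF S) (f : V → S) :
    independentChoices p f = ∏ v, p v (f v) := rfl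

theorem mem_support_independentChoices {p : V → PMF S} {f : V → S} :
    f ∈ (independentChoices p).support ↔ ∀ v, f v ∈ (p v).support := by
  simp [PMF.mem_support_iff, independentChoices_apply, Finset.prod_eq_zero_iff]

theorem independentChoices_pure (a : V → S) :
    independentChoices (fun v => PMF.pure (a v)) = PMF.pure a := by
  classical
  ext f
  rw [independentChoices_apply, PMF.pure_apply]
  simp only [PMF.pure_apply, funext_iff]
  exact Finset.prod_boole.trans (by simp)

/-- Distributivity of products over finite sums. It separates the coins of a round from the states
computed from them. -/
theorem independentChoices_map [Fintype S] (p : V → PMF S) (g : V → S → T) :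
    independentChoices (fun v => (p v).map (g v))
      = (independentChoices p).map fun f v => g v (f v) := by
  classical
  ext b
  rw [independentChoices_apply, PMF.map_apply]
  simp only [PMF.map_apply, tsum_fintype, independentChoices_apply]
  rw [Finset.prod_univ_sum, Fintype.piFinset_univ]
  refine Finset.sum_congr rfl fun f _ => ?_
  rw [Finset.prod_ite_zero]
  simp [funext_iff]

end independentChoices

section coins

variable {V : Type} [Fintype V] (q : V → PMF Bool)

/-- The probability that independent coins with laws `q` show `f`. -/
noncomputable def coinsProb (f : V → Bool) : ℝ := ∏ v, (q v (f v)).toReal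

theorem coinsProb_nonneg (f : V → Bool) : 0 ≤ coinsProb q f :=
  Finset.prod_nonneg fun _ _ => ENNReal.toReal_nonneg

variable [DecidableEq V]

theorem expect_independentChoices_ofReal {g : (V → Bool) → ℝ} (hg : ∀ f, 0 ≤ g f) :
    (independentChoices q).expect (fun f => ENNReal.ofReal (g f))
      = ENNReal.ofReal (∑ f, coinsProb q f * g f) := by
  rw [PMF.expect, tsum_fintype,
    ENNReal.ofReal_sum_of_nonneg fun f _ => mul_nonneg (coinsProb_nonneg q f) (hg f)]
  refine Finset.sum_congr rfl fun f _ => ?_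
  rw [ENNReal.ofReal_mul (coinsProb_nonneg q f), independentChoices_apply, coinsProb,
    ENNReal.ofReal_prod_of_nonneg fun _ _ => ENNReal.toReal_nonneg]
  congr 1
  exact Finset.prod_congr rfl fun v _ => (ENNReal.ofReal_toReal (PMF.apply_ne_top _ _)).symm

theorem coin_true_add_false (μ : PMF Bool) : (μ true).toReal + (μ false).toReal = 1 := by
  rw [← ENNReal.toReal_add (PMF.apply_ne_top _ _) (PMF.apply_ne_top _ _)]
  have := μ.tsum_coe
  rw [tsum_fintype, Fintype.sum_bool] at this
  simp [this]

/-- Independence: expectations of products over the nodes factor. -/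
theorem sum_coinsProb_mul_prod (a : V → Bool → ℝ) :
    ∑ f, coinsProb q f * ∏ v, a v (f v)
      = ∏ v, ((q v true).toReal * a v true + (q v false).toReal * a v false) := by
  have := Finset.prod_univ_sum (fun _ : V => (Finset.univ : Finset Bool))
    (fun v b => (q v b).toReal * a v b)
  rw [Fintype.piFinset_univ] at this
  simp only [Fintype.sum_bool] at this
  rw [this]
  simp only [coinsProb, Finset.prod_mul_distrib]

theorem sum_coinsProb : ∑ f, coinsProb q f = 1 := by
  simpa [coin_true_add_false] using sum_coinsProb_mul_prod q fun _ _ => 1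

theorem sum_coinsProb_forall_false (T : Finset V) :
    ∑ f, coinsProb q f * (if ∀ u ∈ T, f u = false then 1 else 0)
      = ∏ u ∈ T, (q u false).toReal := by
  have := sum_coinsProb_mul_prod q fun v b => if v ∈ T then (if b = false then 1 else 0) else 1
  calc _ = _ := by
        refine Finset.sum_congr rfl fun f _ => ?_
        congr 1
        rw [Finset.prod_ite_mem, Finset.univ_inter, Finset.prod_boole]
        congr
    _ = _ := this
    _ = _ := by
        rw [← Finset.univ_inter T, ← Finset.prod_ite_mem]
        refine Finset.prod_congr rfl fun v _ => ?_
        have := coin_true_add_false (q v)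
        simp only [Finset.univ_inter]
        split_ifs <;> simp_all

theorem sum_coinsProb_true (u : V) :
    ∑ f, coinsProb q f * (if f u = true then 1 else 0) = (q u true).toReal := by
  have h := sum_coinsProb_forall_false q {u}
  simp only [Finset.mem_singleton, forall_eq, Finset.prod_singleton] at h
  have h1 := sum_coinsProb q
  have h2 := coin_true_add_false (q u)
  have : ∑ f, coinsProb q f * (if f u = true then 1 else 0)
      + ∑ f, coinsProb q f * (if f u = false then 1 else 0) = 1 := by
    refine Eq.trans ?_ h1
    rw [← Finset.sum_add_distrib]
    refine Finset.sum_congr rfl fun f _ => ?_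
    cases f u <;> simp
  linarith

open scoped NNReal in
/-- A coin that shows `true` with probability `min p 1`. -/
noncomputable def coin (p : ℝ≥0) : PMF Bool :=
  PMF.ofFintype (fun b => ((cond b (min p 1) (1 - min p 1) : ℝ≥0) : ENNReal)) (by
    rw [Fintype.sum_bool, cond_true, cond_false, ← ENNReal.coe_add,
      add_tsub_cancel_of_le (min_le_right p 1), ENNReal.coe_one])

open scoped NNReal in
theorem coin_true (p : ℝ≥0) : (coin p true).toReal = min (p : ℝ) 1 := by
  rw [coin, PMF.ofFintype_apply, cond_true, ENNReal.coe_toReal, NNReal.coe_min, NNReal.coe_one]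

open scoped NNReal in
theorem coin_false (p : ℝ≥0) : (coin p false).toReal = 1 - min (p : ℝ) 1 := by
  have := coin_true_add_false (coin p)
  rw [coin_true] at this
  linarith

theorem coin_one : coin 1 = PMF.pure true := by
  ext b
  cases b <;> simp [coin, PMF.ofFintype_apply, PMF.pure_apply]

end coins

/-! ### The primal-dual process. -/

open scoped NNReal in
/-- The parameters of one iteration of the primal-dual process: whether values of dominated nodes
count for the load, the threshold on the load at which a node is a candidate, the probability with
which candidates join, and the factor by which values of undominated nodes are multiplied. -/
structure IterationParams where
  countAll : Bool
  threshold : ℝ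
  prob : ℝ≥0
  factor : ℝ

/-- The state of the primal-dual process: the nodes that joined, and the packing values. -/
structure PackingState (V : Type) where
  joined : Finset V
  value : V → ℝ

section process

open Classical NNReal

variable {V : Type} [Fintype V] (N : Network V)

namespace Network

/-- The nodes that are not dominated by `S`. -/
noncomputable def undominated (S : Finset V) : Finset V :=
  {v | ∀ u ∈ N.closedNbhd v, u ∉ S}

theorem mem_undominated {S : Finset V} {v : V} :
    v ∈ N.undominated S ↔ ∀ u ∈ N.closedNbhd v, u ∉ S := by
  simp [undominated]

theorem undominated_anti {S T : Finset V} (h : S ⊆ T) : N.undominated T ⊆ N.undominated S := by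
  intro v hv
  rw [mem_undominated] at *
  exact fun u hu hS => hv u hu (h hS)

theorem isDominatingSet_of_undominated_eq_empty {S : Finset V} (h : N.undominated S = ∅) :
    IsDominatingSet N.graph S := by
  intro v
  have hv : v ∉ N.undominated S := by simp [h]
  rw [mem_undominated] at hv
  push Not at hv
  obtain ⟨u, hu, hS⟩ := hv
  rcases N.mem_closedNbhd.1 hu with rfl | hu
  · exact Or.inl hS
  · exact Or.inr ⟨u, hS, hu⟩

end Network

namespace PackingState

/-- The total value in the closed neighborhood of `u`, either of all or of undominated nodes. -/
noncomputable def load (all : Bool) (s : PackingState V) (u : V) : ℝ :=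
  ∑ v ∈ N.closedNbhd u with all = true ∨ v ∈ N.undominated s.joined, s.value v

/-- The nodes whose load is at least their weight divided by `θ`. -/
noncomputable def candidates (all : Bool) (θ : ℝ) (s : PackingState V) : Finset V :=
  {u | (N.weight u : ℝ) ≤ θ * s.load N all u}

/-- The state after the nodes `u` with `f u = true` have joined. -/
noncomputable def update (factor : ℝ) (s : PackingState V) (f : V → Bool) : PackingState V where
  joined := s.joined ∪ ({u | f u = true} : Finset V)
  value v := if v ∈ N.undominated (s.joined ∪ ({u | f u = true} : Finset V))
    then factor * s.value v else s.value v

/-- The law of the decision of `u` to join. -/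
noncomputable def joinLaw (a : IterationParams) (s : PackingState V) (u : V) : PMF Bool :=
  if u ∈ s.candidates N a.countAll a.threshold then coin a.prob else PMF.pure false

/-- The law of the state after one iteration. -/
noncomputable def iterationLaw (a : IterationParams) (s : PackingState V) :
    PMF (PackingState V) :=
  (independentChoices (s.joinLaw N a)).map (s.update N a.factor)

/-- The law of the state after the iterations listed in a schedule. -/
noncomputable def runLaw : List IterationParams → PackingState V → PMF (PackingState V)
  | [], s => PMF.pure s
  | a :: L, s => (s.iterationLaw N a).bind (runLaw L)

theorem runLaw_append (L M : List IterationParams) (s : PackingState V) :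
    runLaw N (L ++ M) s = (runLaw N L s).bind (runLaw N M) := by
  induction L generalizing s with
  | nil => simp [runLaw]
  | cons a L ih => simp only [List.cons_append, runLaw, PMF.bind_bind, funext ih]

/-- Covers the deterministic stage and the closing iteration of each sampling phase. -/
theorem iterationLaw_of_prob_eq_one {a : IterationParams} (ha : a.prob = 1)
    (s : PackingState V) :
    s.iterationLaw N a = PMF.pure (s.update N a.factor
      fun u => decide (u ∈ s.candidates N a.countAll a.threshold)) := by
  have : s.joinLaw N a
      = fun u => PMF.pure (decide (u ∈ s.candidates N a.countAll a.threshold)) := by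
    funext u
    rw [joinLaw, ha, coin_one]
    split_ifs with h <;> simp [h]
  rw [iterationLaw, this, independentChoices_pure, PMF.pure_map]

theorem joined_subset_update (factor : ℝ) (s : PackingState V) (f : V → Bool) :
    s.joined ⊆ (s.update N factor f).joined := Finset.subset_union_left

theorem undominated_update_subset (factor : ℝ) (s : PackingState V) (f : V → Bool) :
    N.undominated (s.update N factor f).joined ⊆ N.undominated s.joined :=
  N.undominated_anti (s.joined_subset_update N factor f)

theorem mem_undominated_update {factor : ℝ} {s : PackingState V} {f : V → Bool} {v : V} :
    v ∈ N.undominated (s.update N factor f).joined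
      ↔ v ∈ N.undominated s.joined ∧ ∀ u ∈ N.closedNbhd v, f u = false := by
  simp only [Network.mem_undominated, update, Finset.mem_union, Finset.mem_filter,
    Finset.mem_univ, true_and, not_or, Bool.not_eq_true]
  exact forall₂_and

theorem value_update_of_mem {factor : ℝ} {s : PackingState V} {f : V → Bool} {v : V}
    (h : v ∈ N.undominated (s.update N factor f).joined) :
    (s.update N factor f).value v = factor * s.value v := if_pos h

theorem value_update_of_notMem {factor : ℝ} {s : PackingState V} {f : V → Bool} {v : V}
    (h : v ∉ N.undominated (s.update N factor f).joined) :
    (s.update N factor f).value v = s.value v := if_neg h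

theorem value_update_one (s : PackingState V) (f : V → Bool) :
    (s.update N 1 f).value = s.value := by
  funext v
  simp [update]

/-! ### The deterministic stage -/

/-- The invariant of the stage in which all candidates join: the values are a feasible packing that
is almost tight at the nodes that joined. -/
structure IsTightPacking (ε r : ℝ) (s : PackingState V) : Prop where
  nonneg : ∀ v, 0 ≤ s.value v
  le : ∀ v, s.value v ≤ r * N.minWeight v
  eq_of_undominated : ∀ v ∈ N.undominated s.joined, s.value v = r * N.minWeight v
  sum_le : ∀ u, ∑ v ∈ N.closedNbhd u, s.value v ≤ N.weight u
  le_sum : ∀ u ∈ s.joined, (N.weight u : ℝ) ≤ (1 + ε) * ∑ v ∈ N.closedNbhd u, s.value v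

variable {N}

theorem load_true (s : PackingState V) (u : V) :
    s.load N true u = ∑ v ∈ N.closedNbhd u, s.value v := by
  simp [load]

theorem load_false (s : PackingState V) (u : V) :
    s.load N false u = ∑ v ∈ N.closedNbhd u with v ∈ N.undominated s.joined, s.value v := by
  simp [load]

/-- A candidate dominates its whole closed neighborhood and so freezes all values there; any other
node has room for a factor `1 + ε`. Tightness at joined nodes persists because loads never decrease.
-/
theorem IsTightPacking.update {ε r : ℝ} (hε : 0 ≤ ε) {s : PackingState V}
    (h : s.IsTightPacking N ε r) :
    (s.update N (1 + ε) fun u => decide (u ∈ s.candidates N true (1 + ε))).IsTightPacking N ε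
      (r * (1 + ε)) := by
  set s' := s.update N (1 + ε) fun u => decide (u ∈ s.candidates N true (1 + ε)) with hs'
  have hmono : ∀ v, s.value v ≤ s'.value v := by
    intro v
    have := h.nonneg v
    by_cases hv : v ∈ N.undominated s'.joined
    · rw [hs', value_update_of_mem N hv]
      nlinarith
    · rw [hs', value_update_of_notMem N hv]
  have hup : ∀ v, s'.value v ≤ (1 + ε) * s.value v := by
    intro v
    have := h.nonneg v
    by_cases hv : v ∈ N.undominated s'.joined
    · rw [hs', value_update_of_mem N hv]
    · rw [hs', value_update_of_notMem N hv]
      nlinarith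
  have hsum : ∀ u, ∑ v ∈ N.closedNbhd u, s.value v ≤ ∑ v ∈ N.closedNbhd u, s'.value v :=
    fun u => Finset.sum_le_sum fun v _ => hmono v
  refine ⟨fun v => (h.nonneg v).trans (hmono v), fun v => ?_, fun v hv => ?_, fun u => ?_,
    fun u hu => ?_⟩
  · have := h.le v
    have := hup v
    nlinarith
  · rw [hs', value_update_of_mem N hv,
      h.eq_of_undominated v (s.undominated_update_subset N _ _ hv)]
    ring
  · by_cases hu : u ∈ s.candidates N true (1 + ε)
    · refine le_trans (Finset.sum_le_sum fun v hv => ?_) (h.sum_le u)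
      rw [hs', value_update_of_notMem]
      rw [mem_undominated_update]
      rintro ⟨-, hf⟩
      have := hf u (N.mem_closedNbhd_comm.1 hv)
      simp [hu] at this
    · have hlt : (1 + ε) * ∑ v ∈ N.closedNbhd u, s.value v < N.weight u := by
        simpa [candidates, load_true] using hu
      refine le_trans (Finset.sum_le_sum fun v _ => hup v) ?_
      rw [← Finset.mul_sum]
      exact hlt.le
  · have key : (N.weight u : ℝ) ≤ (1 + ε) * ∑ v ∈ N.closedNbhd u, s.value v := by
      rcases Finset.mem_union.1 hu with hu | hu
      · exact h.le_sum u hu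
      · simpa [candidates, load_true] using hu
    have := hsum u
    nlinarith

/-- The iteration of the deterministic stage. -/
noncomputable def tightIteration (ε : ℝ) : IterationParams := ⟨true, 1 + ε, 1, 1 + ε⟩

theorem IsTightPacking.run {ε r : ℝ} (hε : 0 ≤ ε) {s : PackingState V}
    (h : s.IsTightPacking N ε r) (n : ℕ) :
    ∀ s' ∈ (runLaw N (List.replicate n (tightIteration ε)) s).support,
      s'.IsTightPacking N ε (r * (1 + ε) ^ n) := by
  induction n generalizing r s with
  | zero =>
    intro s' hs'
    simp only [List.replicate_zero, runLaw, PMF.mem_support_pure_iff] at hs'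
    simpa [hs'] using h
  | succ n ih =>
    intro s' hs'
    rw [List.replicate_succ, runLaw, iterationLaw_of_prob_eq_one N rfl, PMF.pure_bind] at hs'
    have := ih (h.update hε) s' hs'
    rwa [mul_assoc, ← pow_succ'] at this

theorem isTightPacking_initial {ε r : ℝ} (hr : 0 ≤ r) (h : r * (N.maxDegree + 1) ≤ 1) :
    (⟨∅, fun v => r * N.minWeight v⟩ : PackingState V).IsTightPacking N ε r := by
  refine ⟨fun v => by positivity, fun v => le_rfl, fun v _ => rfl, fun u => ?_, fun u hu => ?_⟩
  · calc ∑ v ∈ N.closedNbhd u, r * (N.minWeight v : ℝ)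
        ≤ ∑ v ∈ N.closedNbhd u, r * (N.weight u : ℝ) := by
          refine Finset.sum_le_sum fun v hv => ?_
          have := N.minWeight_le (N.mem_closedNbhd_comm.1 hv)
          gcongr
      _ = (r * (N.closedNbhd u).card) * N.weight u := by
          rw [Finset.sum_const, nsmul_eq_mul]; ring
      _ ≤ 1 * N.weight u := by
          gcongr
          refine le_trans ?_ h
          gcongr
          exact_mod_cast N.card_closedNbhd_le u
      _ = N.weight u := one_mul _
  · simp at hu

theorem IsTightPacking.weightOf_le {ε r : ℝ} {α : ℕ} (hα : arboricity N.graph ≤ (α : ℕ∞))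
    (hε : 0 ≤ ε) (hε' : ε ≤ 1 / 4) (hr : 0 ≤ r) (hr' : r * (α + 1) ≤ ε) {s : PackingState V}
    (h : s.IsTightPacking N ε r) :
    (N.weightOf s.joined : ℝ) ≤ α * (1 + 4 * ε) * N.opt := by
  have h1 := N.sum_load_le hα hr h.nonneg (fun u v hv => (h.le v).trans (by
    have := N.minWeight_le (N.mem_closedNbhd_comm.1 hv)
    gcongr)) s.joined
  have h2 : ∑ v, s.value v ≤ N.opt :=
    N.sum_le_opt (T := Finset.univ) (fun v _ => h.nonneg v) (by simpa using h.sum_le)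
  have h3 : (N.weightOf s.joined : ℝ)
      ≤ (1 + ε) * ∑ u ∈ s.joined, ∑ v ∈ N.closedNbhd u, s.value v := by
    rw [Network.weightOf, Finset.mul_sum]
    push_cast
    exact Finset.sum_le_sum h.le_sum
  set W : ℝ := (N.weightOf s.joined : ℝ)
  have hW : 0 ≤ W := Nat.cast_nonneg _
  have h4 : W ≤ (1 + ε) * (ε * W + α * N.opt) := by
    refine h3.trans ?_
    gcongr
    refine h1.trans ?_
    gcongr
    linarith
  have h5 : 0 ≤ (α : ℝ) * N.opt := by positivity
  have h6 : (1 - ε - ε ^ 2) * W ≤ (1 + ε) * (α * N.opt) := by nlinarith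
  -- After cancellation this is `5 * ε + 4 * ε ^ 2 ≤ 2` times `ε`, which `ε ≤ 1 / 4` ensures.
  have h7 : 1 + ε ≤ (1 - ε - ε ^ 2) * (1 + 4 * ε) := by nlinarith
  have h8 : 0 < 1 - ε - ε ^ 2 := by nlinarith
  have h9 : (1 - ε - ε ^ 2) * W ≤ (1 - ε - ε ^ 2) * (α * (1 + 4 * ε) * N.opt) := by
    nlinarith
  exact le_of_mul_le_mul_left h9 h8

end PackingState

end process

/-! ### The sampling stage. -/

section samplingStage

open Classical NNReal

variable {V : Type} [Fintype V] {N : Network V}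

namespace PackingState

/-- The invariant of the sampling stage: the values of the undominated nodes are a feasible
packing. -/
structure IsUniformPacking (N : Network V) (r : ℝ) (s : PackingState V) : Prop where
  eq_of_undominated : ∀ v ∈ N.undominated s.joined, s.value v = r * N.minWeight v
  load_le : ∀ u, s.load N false u ≤ N.weight u

theorem IsTightPacking.isUniformPacking {ε r : ℝ} {s : PackingState V}
    (h : s.IsTightPacking N ε r) : s.IsUniformPacking N r := by
  refine ⟨h.eq_of_undominated, fun u => le_trans ?_ (h.sum_le u)⟩
  rw [load_false]
  exact Finset.sum_le_sum_of_subset_of_nonneg (Finset.filter_subset _ _) fun v _ _ => h.nonneg v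

theorem IsUniformPacking.nonneg {r : ℝ} (hr : 0 ≤ r) {s : PackingState V}
    (h : s.IsUniformPacking N r) {v : V} (hv : v ∈ N.undominated s.joined) : 0 ≤ s.value v := by
  rw [h.eq_of_undominated v hv]
  positivity

theorem IsUniformPacking.sum_le_opt {r : ℝ} (hr : 0 ≤ r) {s : PackingState V}
    (h : s.IsUniformPacking N r) : ∑ v ∈ N.undominated s.joined, s.value v ≤ N.opt :=
  N.sum_le_opt (fun _ hv => h.nonneg hr hv) fun u => by
    simpa [load_false] using h.load_le u

/-- An undominated node would by itself overload the lightest node of its closed neighborhood. -/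
theorem IsUniformPacking.undominated_eq_empty {r : ℝ} (hr : 1 < r) {s : PackingState V}
    (h : s.IsUniformPacking N r) : N.undominated s.joined = ∅ := by
  rw [Finset.eq_empty_iff_forall_notMem]
  intro v hv
  obtain ⟨u, hu, huw⟩ := N.exists_weight_eq_minWeight v
  have h1 : s.value v ≤ s.load N false u := by
    rw [load_false]
    refine Finset.single_le_sum (f := s.value) (fun w hw => ?_) ?_
    · exact h.nonneg (by linarith) (Finset.mem_filter.1 hw).2
    · exact Finset.mem_filter.2 ⟨N.mem_closedNbhd_comm.1 hu, hv⟩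
  have h2 := h.load_le u
  rw [h.eq_of_undominated v hv] at h1
  rw [huw] at h2
  have h3 : (0 : ℝ) < N.minWeight v := by exact_mod_cast N.minWeight_pos v
  nlinarith

/-- The number of candidates that can dominate `v`. -/
noncomputable def candidateDegree (N : Network V) (γ : ℝ) (s : PackingState V) (v : V) : ℕ :=
  ({u ∈ N.closedNbhd v | u ∈ s.candidates N false γ} : Finset V).card

/-- An upper bound on the expected weight at the end of a sampling phase whose next sampling
probability is `p`. -/
noncomputable def potential (N : Network V) (γ p : ℝ) (s : PackingState V) : ℝ :=
  N.weightOf s.joined + ∑ v ∈ N.undominated s.joined,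
    γ * s.value v * (p * s.candidateDegree N γ v + γ)

/-- The expectation of the potential after an iteration, with the values and the candidates before
the iteration, is at most the potential before the iteration. -/
theorem sum_coinsProb_mul_le_potential {a : IterationParams} (ha : a.countAll = false)
    {γ : ℝ} (haγ : a.threshold = γ) (hγ : 0 ≤ γ) {q : ℝ} (hq : q ≤ γ * min (a.prob : ℝ) 1)
    {s : PackingState V} (hs : ∀ v ∈ N.undominated s.joined, 0 ≤ s.value v) :
    ∑ f, coinsProb (s.joinLaw N a) f *
        (N.weightOf (s.update N a.factor f).joined
          + ∑ v ∈ N.undominated (s.update N a.factor f).joined,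
            γ * s.value v * (q * s.candidateDegree N γ v + γ))
      ≤ s.potential N γ (min (a.prob : ℝ) 1) := by
  set p : ℝ := min (a.prob : ℝ) 1 with hp
  have hp0 : 0 ≤ p := le_min a.prob.coe_nonneg zero_le_one
  have hp1 : p ≤ 1 := min_le_right _ _
  set h : V → ℝ := fun v => γ * s.value v * (q * s.candidateDegree N γ v + γ) with hh
  set P := coinsProb (s.joinLaw N a)
  have hP1 : ∀ u, ∑ f, P f * (if f u = true then 1 else 0) = (s.joinLaw N a u true).toReal :=
    sum_coinsProb_true _
  have hP2 : ∀ T : Finset V, ∑ f, P f * (if ∀ u ∈ T, f u = false then 1 else 0)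
      = ∏ u ∈ T, (s.joinLaw N a u false).toReal := fun T => by
    rw [← sum_coinsProb_forall_false]
  have hlaw : ∀ u, s.joinLaw N a u
      = if u ∈ s.candidates N false γ then coin a.prob else PMF.pure false := by
    intro u
    rw [joinLaw, ha, haγ]
  have htrue : ∀ u, (s.joinLaw N a u true).toReal
      = if u ∈ s.candidates N false γ then p else 0 := by
    intro u
    rw [hlaw]
    split_ifs
    · exact coin_true _
    · simp [PMF.pure_apply]
  have hfalse : ∀ u, (s.joinLaw N a u false).toReal
      = if u ∈ s.candidates N false γ then 1 - p else 1 := by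
    intro u
    rw [hlaw]
    split_ifs
    · exact coin_false _
    · simp [PMF.pure_apply]
  have hpt : ∀ f, P f * (N.weightOf (s.update N a.factor f).joined
          + ∑ v ∈ N.undominated (s.update N a.factor f).joined, h v)
      ≤ P f * N.weightOf s.joined
        + ∑ u, N.weight u * (P f * (if f u = true then 1 else 0))
        + ∑ v ∈ N.undominated s.joined,
            h v * (P f * if ∀ u ∈ N.closedNbhd v, f u = false then 1 else 0) := by
    intro f
    have e1 : (N.weightOf (s.update N a.factor f).joined : ℝ)
        ≤ N.weightOf s.joined + ∑ u, N.weight u * (if f u = true then (1 : ℝ) else 0) := by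
      have : N.weightOf (s.update N a.factor f).joined
          ≤ N.weightOf s.joined + ∑ u with f u = true, N.weight u := by
        simp only [Network.weightOf, update]
        rw [← Finset.sum_union_inter]
        exact Nat.le_add_right _ _
      rw [Finset.sum_filter] at this
      refine (Nat.cast_le.2 this).trans_eq ?_
      push_cast
      congr 1
      exact Finset.sum_congr rfl fun u _ => by split_ifs <;> simp
    have e2 : ∑ v ∈ N.undominated (s.update N a.factor f).joined, h v
        = ∑ v ∈ N.undominated s.joined,
            h v * (if ∀ u ∈ N.closedNbhd v, f u = false then 1 else 0) := by
      simp only [mul_ite, mul_one, mul_zero]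
      rw [← Finset.sum_filter]
      congr 1
      ext v
      rw [Finset.mem_filter, mem_undominated_update]
    rw [e2]
    refine (mul_le_mul_of_nonneg_left (add_le_add_left e1 _) (coinsProb_nonneg _ f)).trans_eq ?_
    rw [mul_add, mul_add, Finset.mul_sum, Finset.mul_sum]
    congr 1
    · congr 1
      exact Finset.sum_congr rfl fun u _ => by ring
    · exact Finset.sum_congr rfl fun u _ => by ring
  refine (Finset.sum_le_sum fun f _ => hpt f).trans ?_
  rw [Finset.sum_add_distrib, Finset.sum_add_distrib, ← Finset.sum_mul, sum_coinsProb, one_mul,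
    Finset.sum_comm]
  simp only [← Finset.mul_sum, hP1, htrue]
  rw [Finset.sum_comm]
  simp only [← Finset.mul_sum, hP2, hfalse]
  -- A candidate's weight is at most `γ` times its load; exchanging sums charges each undominated
  -- `v` once per candidate near it.
  have hjoin : ∑ u, (N.weight u : ℝ) * (if u ∈ s.candidates N false γ then p else 0)
      ≤ ∑ v ∈ N.undominated s.joined, γ * s.value v * (p * s.candidateDegree N γ v) := by
    calc _ = ∑ u ∈ s.candidates N false γ, (N.weight u : ℝ) * p := by
          simp only [mul_ite, mul_zero, Finset.sum_ite_mem, Finset.univ_inter]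
      _ ≤ ∑ u ∈ s.candidates N false γ, γ * p * (1 * s.load N false u) := by
          refine Finset.sum_le_sum fun u hu => ?_
          have : (N.weight u : ℝ) ≤ γ * s.load N false u := (Finset.mem_filter.1 hu).2
          nlinarith
      _ = γ * p * ∑ v ∈ N.undominated s.joined, s.value v * s.candidateDegree N γ v := by
          rw [← Finset.mul_sum]
          simp only [load_false]
          rw [N.sum_sum_closedNbhd _ _ s.value fun _ => 1]
          simp [candidateDegree]
      _ = _ := by
          rw [Finset.mul_sum]
          exact Finset.sum_congr rfl fun v _ => by ring
  -- The next coefficient `q * c + γ` is at most `γ * (p * c + 1)`, and the survival probability `(1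
  -- - p) ^ c ≤ exp (-(p * c))` absorbs the factor `p * c + 1`.
  have hsurvive : ∀ v ∈ N.undominated s.joined,
      h v * ∏ u ∈ N.closedNbhd v, (if u ∈ s.candidates N false γ then 1 - p else 1)
        ≤ γ * s.value v * γ := by
    intro v hv
    have hx := hs v hv
    set c : ℝ := (s.candidateDegree N γ v : ℝ) with hc
    have hc0 : 0 ≤ c := Nat.cast_nonneg _
    have hprod : ∏ u ∈ N.closedNbhd v, (if u ∈ s.candidates N false γ then 1 - p else 1)
        = (1 - p) ^ s.candidateDegree N γ v := by
      rw [← Finset.prod_filter, Finset.prod_const, candidateDegree]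
    have hpow : (1 - p) ^ s.candidateDegree N γ v ≤ Real.exp (-(p * c)) := by
      calc (1 - p) ^ s.candidateDegree N γ v
          ≤ Real.exp (-p) ^ s.candidateDegree N γ v :=
            pow_le_pow_left₀ (by linarith) (Real.one_sub_le_exp_neg p) _
        _ = Real.exp (-(p * c)) := by rw [← Real.exp_nat_mul, hc]; ring_nf
    have hpow0 : 0 ≤ (1 - p) ^ s.candidateDegree N γ v := pow_nonneg (by linarith) _
    have hexp : (p * c + 1) * Real.exp (-(p * c)) ≤ 1 := by
      rw [Real.exp_neg, ← div_eq_mul_inv, div_le_one (Real.exp_pos _)]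
      exact Real.add_one_le_exp _
    have h1 : q * c + γ ≤ γ * (p * c + 1) := by nlinarith
    rw [hprod]
    calc h v * (1 - p) ^ s.candidateDegree N γ v
        ≤ γ * s.value v * (γ * (p * c + 1)) * (1 - p) ^ s.candidateDegree N γ v := by
          simp only [hh]
          gcongr
      _ ≤ γ * s.value v * (γ * (p * c + 1)) * Real.exp (-(p * c)) := by gcongr
      _ = γ * s.value v * γ * ((p * c + 1) * Real.exp (-(p * c))) := by ring
      _ ≤ γ * s.value v * γ * 1 := by gcongr
      _ = _ := mul_one _
  calc _ ≤ (N.weightOf s.joined : ℝ)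
        + ∑ v ∈ N.undominated s.joined, γ * s.value v * (p * s.candidateDegree N γ v)
        + ∑ v ∈ N.undominated s.joined, γ * s.value v * γ :=
        add_le_add (add_le_add_right hjoin _) (Finset.sum_le_sum hsurvive)
    _ = _ := by
      rw [add_assoc, ← Finset.sum_add_distrib, potential]
      simp only [mul_add]

/-- An iteration in which the candidates join with probability `p`. -/
noncomputable def samplingIteration (γ p : ℝ≥0) : IterationParams := ⟨false, γ, p, 1⟩

/-- The last iteration of a sampling phase: all candidates join, and the values of the nodes that
stay undominated increase by the factor `γ`. -/
noncomputable def closingIteration (γ : ℝ≥0) : IterationParams := ⟨false, γ, 1, γ⟩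

/-- A phase that samples with probabilities `p`, `γ * p`, ..., and finally with probability `1`. -/
noncomputable def samplingPhase (γ : ℝ≥0) : ℝ≥0 → ℕ → List IterationParams
  | _, 0 => [closingIteration γ]
  | p, n + 1 => samplingIteration γ p :: samplingPhase γ (γ * p) n

theorem load_update_one_le {r : ℝ} (hr : 0 ≤ r) {s : PackingState V}
    (h : s.IsUniformPacking N r) (f : V → Bool) (u : V) :
    (s.update N 1 f).load N false u ≤ s.load N false u := by
  rw [load_false, load_false, value_update_one]
  refine Finset.sum_le_sum_of_subset_of_nonneg ?_ fun v hv _ =>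
    h.nonneg hr (Finset.mem_filter.1 hv).2
  exact Finset.monotone_filter_right _ fun v _ hv => s.undominated_update_subset N _ _ hv

theorem IsUniformPacking.update_one {r : ℝ} (hr : 0 ≤ r) {s : PackingState V}
    (h : s.IsUniformPacking N r) (f : V → Bool) : (s.update N 1 f).IsUniformPacking N r := by
  refine ⟨fun v hv => ?_, fun u => (load_update_one_le hr h f u).trans (h.load_le u)⟩
  rw [value_update_one]
  exact h.eq_of_undominated v (s.undominated_update_subset N _ _ hv)

theorem candidateDegree_update_one_le {r : ℝ} (hr : 0 ≤ r) {γ : ℝ} (hγ : 0 ≤ γ)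
    {s : PackingState V} (h : s.IsUniformPacking N r) (f : V → Bool) (v : V) :
    (s.update N 1 f).candidateDegree N γ v ≤ s.candidateDegree N γ v := by
  refine Finset.card_le_card (Finset.monotone_filter_right _ fun u _ hu => ?_)
  simp only [candidates, Finset.mem_filter, Finset.mem_univ, true_and] at hu ⊢
  have := load_update_one_le hr h f u
  nlinarith

/-- After all candidates join, their loads vanish, and every other node has room for a factor `γ`.
-/
theorem IsUniformPacking.closing {r : ℝ} (hr : 0 ≤ r) {γ : ℝ≥0} {s : PackingState V}
    (h : s.IsUniformPacking N r) :
    (s.update N γ fun u => decide (u ∈ s.candidates N false γ)).IsUniformPacking N (r * γ) := by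
  set f : V → Bool := fun u => decide (u ∈ s.candidates N false γ) with hf
  refine ⟨fun v hv => ?_, fun u => ?_⟩
  · rw [value_update_of_mem N hv,
      h.eq_of_undominated v (s.undominated_update_subset N _ _ hv)]
    ring
  · by_cases hu : u ∈ s.candidates N false γ
    · rw [load_false, Finset.sum_eq_zero]
      · positivity
      · intro v hv
        rw [Finset.mem_filter, mem_undominated_update] at hv
        have := hv.2.2 u (N.mem_closedNbhd_comm.1 hv.1)
        simp [hf, hu] at this
    · have hlt : (γ : ℝ) * s.load N false u < N.weight u := by
        simpa [candidates] using hu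
      refine le_trans ?_ hlt.le
      rw [load_false, load_false, Finset.mul_sum]
      calc _ = ∑ v ∈ N.closedNbhd u with v ∈ N.undominated (s.update N γ f).joined,
              γ * s.value v :=
            Finset.sum_congr rfl fun v hv => value_update_of_mem N (Finset.mem_filter.1 hv).2
        _ ≤ _ := by
            refine Finset.sum_le_sum_of_subset_of_nonneg ?_ fun v hv _ =>
              mul_nonneg γ.coe_nonneg (h.nonneg hr (Finset.mem_filter.1 hv).2)
            exact Finset.monotone_filter_right _ fun v _ hv =>
              s.undominated_update_subset N _ _ hv

theorem potential_nonneg {γ p r : ℝ} (hγ : 0 ≤ γ) (hp : 0 ≤ p) (hr : 0 ≤ r)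
    {s : PackingState V} (h : s.IsUniformPacking N r) : 0 ≤ s.potential N γ p := by
  refine add_nonneg (Nat.cast_nonneg _) (Finset.sum_nonneg fun v hv => ?_)
  have := h.nonneg hr hv
  positivity

theorem IsUniformPacking.run_samplingPhase {r : ℝ} (hr : 0 ≤ r) {γ : ℝ≥0} (n : ℕ) (p : ℝ≥0)
    {s : PackingState V} (h : s.IsUniformPacking N r) :
    ∀ s' ∈ (runLaw N (samplingPhase γ p n) s).support, s'.IsUniformPacking N (r * γ) := by
  induction n generalizing p s with
  | zero =>
    intro s' hs'
    rw [samplingPhase, runLaw, iterationLaw_of_prob_eq_one N rfl, PMF.pure_bind, runLaw,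
      PMF.mem_support_pure_iff] at hs'
    rw [hs']
    exact h.closing hr
  | succ n ih =>
    intro s' hs'
    rw [samplingPhase, runLaw, iterationLaw, PMF.bind_map, PMF.mem_support_bind_iff] at hs'
    obtain ⟨f, -, hf⟩ := hs'
    exact ih _ (h.update_one hr f) s' hf

/-- The potential is a supermartingale along the phase: sampling iterations keep the values, so
loads and candidate degrees only shrink. The condition on `p` says that the last probability has
reached `1`. -/
theorem expect_samplingPhase_le {r : ℝ} (hr : 0 ≤ r) {γ : ℝ≥0} (hγ : 1 ≤ γ) (n : ℕ) (p : ℝ≥0)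
    (hp : 1 ≤ γ ^ n * p) {s : PackingState V} (h : s.IsUniformPacking N r) :
    (runLaw N (samplingPhase γ p n) s).expect
        (fun s' => ENNReal.ofReal (N.weightOf s'.joined))
      ≤ ENNReal.ofReal (s.potential N γ (min (p : ℝ) 1)) := by
  induction n generalizing p s with
  | zero =>
    have hp1 : (1 : ℝ) ≤ p := by simpa using hp
    rw [samplingPhase, runLaw, iterationLaw, PMF.bind_map, PMF.expect_bind]
    simp only [Function.comp_apply, runLaw, PMF.expect_pure]
    rw [expect_independentChoices_ofReal _ fun f => Nat.cast_nonneg _]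
    refine ENNReal.ofReal_le_ofReal ?_
    -- No sampling follows, so `q = 0` suffices; the leftover potential is nonnegative and is
    -- dropped.
    have := sum_coinsProb_mul_le_potential (N := N) (a := closingIteration γ) rfl rfl γ.coe_nonneg
      (q := 0) (mul_nonneg γ.coe_nonneg (le_min (NNReal.coe_nonneg _) zero_le_one)) (s := s) fun v hv => h.nonneg hr hv
    have e : min ((closingIteration γ).prob : ℝ) 1 = min (p : ℝ) 1 := by
      simp [closingIteration, hp1]
    rw [e] at this
    refine le_trans (Finset.sum_le_sum fun f _ => ?_) this
    refine mul_le_mul_of_nonneg_left ?_ (coinsProb_nonneg _ f)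
    refine le_add_of_nonneg_right (Finset.sum_nonneg fun v hv => ?_)
    have := h.nonneg hr (s.undominated_update_subset N _ _ hv)
    have := γ.coe_nonneg
    simp only [zero_mul, zero_add]
    exact mul_nonneg (mul_nonneg γ.coe_nonneg ‹_›) γ.coe_nonneg
  | succ n ih =>
    rw [samplingPhase, runLaw, iterationLaw, PMF.bind_map, PMF.expect_bind]
    refine le_trans (PMF.expect_mono_of_support _ fun f _ =>
      ih (γ * p) (by rwa [← mul_assoc, ← pow_succ]) (h.update_one hr f)) ?_
    rw [show (samplingIteration γ p).factor = 1 from rfl]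
    rw [expect_independentChoices_ofReal _ fun f =>
      potential_nonneg γ.coe_nonneg (le_min (γ * p).coe_nonneg zero_le_one) hr (h.update_one hr f)]
    refine ENNReal.ofReal_le_ofReal ?_
    have hγ' : (1 : ℝ) ≤ γ := by exact_mod_cast hγ
    have hq : min ((γ * p : ℝ≥0) : ℝ) 1 ≤ γ * min (p : ℝ) 1 := by
      rw [mul_min_of_nonneg _ _ γ.coe_nonneg, mul_one]
      exact min_le_min (by simp) hγ'
    refine le_trans (Finset.sum_le_sum fun f _ => ?_)
      (sum_coinsProb_mul_le_potential (N := N) (a := samplingIteration γ p) rfl rfl γ.coe_nonneg hq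
        (s := s) fun v hv => h.nonneg hr hv)
    refine mul_le_mul_of_nonneg_left (add_le_add_right (Finset.sum_le_sum fun v hv => ?_) _)
      (coinsProb_nonneg _ f)
    have hx := h.nonneg hr (s.undominated_update_subset N _ _ hv)
    have hc := candidateDegree_update_one_le hr γ.coe_nonneg h f v
    have hq0 : 0 ≤ min ((γ * p : ℝ≥0) : ℝ) 1 := le_min (γ * p).coe_nonneg zero_le_one
    rw [show (samplingIteration γ p).threshold = γ from rfl, value_update_one]
    gcongr

/-- One phase costs at most `γ * (γ + 1)` times the optimum in expectation. -/
theorem expect_samplingPhase_le_add_opt {r : ℝ} (hr : 0 ≤ r) {γ : ℝ≥0} (hγ : 1 ≤ γ) {n : ℕ}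
    (hn : (N.maxDegree : ℝ≥0) + 1 ≤ γ ^ n) {s : PackingState V} (h : s.IsUniformPacking N r) :
    (runLaw N (samplingPhase γ (N.maxDegree + 1)⁻¹ n) s).expect
        (fun s' => ENNReal.ofReal (N.weightOf s'.joined))
      ≤ ENNReal.ofReal (N.weightOf s.joined) + ENNReal.ofReal (γ * (γ + 1) * N.opt) := by
  have hpos : (0 : ℝ≥0) < N.maxDegree + 1 := by positivity
  refine (expect_samplingPhase_le hr hγ n _ ?_ h).trans ?_
  · rw [← div_eq_mul_inv, one_le_div hpos]
    exact hn
  rw [← ENNReal.ofReal_add (Nat.cast_nonneg _) (by positivity)]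
  refine ENNReal.ofReal_le_ofReal (add_le_add_right ?_ _)
  calc _ ≤ ∑ v ∈ N.undominated s.joined, γ * (γ + 1) * s.value v := by
        refine Finset.sum_le_sum fun v hv => ?_
        have hx := h.nonneg hr hv
        have hc : (s.candidateDegree N γ v : ℝ) ≤ N.maxDegree + 1 := by
          exact_mod_cast (Finset.card_filter_le _ _).trans (N.card_closedNbhd_le v)
        -- This is why sampling starts at `1 / (Δ + 1)`: at first at most one candidate near `v` is
        -- expected to join.
        have h1 : min (((N.maxDegree + 1 : ℝ≥0)⁻¹ : ℝ≥0) : ℝ) 1 * s.candidateDegree N γ v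
            ≤ 1 := by
          calc _ ≤ (((N.maxDegree + 1 : ℝ≥0)⁻¹ : ℝ≥0) : ℝ) * (N.maxDegree + 1) := by
                gcongr
                exact min_le_left _ _
            _ = 1 := by
                push_cast
                exact inv_mul_cancel₀ (by positivity)
        have hγ0 := γ.coe_nonneg
        calc _ ≤ (γ : ℝ) * s.value v * (1 + γ) := by gcongr
          _ = _ := by ring
    _ ≤ _ := by
        rw [← Finset.mul_sum]
        have := h.sum_le_opt hr
        gcongr

/-- The sampling stage: `m` phases. -/
noncomputable def samplingStage (γ p : ℝ≥0) (n m : ℕ) : List IterationParams :=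
  (List.replicate m (samplingPhase γ p n)).flatten

theorem IsUniformPacking.run_samplingStage {r : ℝ} (hr : 0 ≤ r) {γ p : ℝ≥0} {n : ℕ} (m : ℕ)
    {s : PackingState V} (h : s.IsUniformPacking N r) :
    ∀ s' ∈ (runLaw N (samplingStage γ p n m) s).support,
      s'.IsUniformPacking N (r * (γ : ℝ) ^ m) := by
  induction m generalizing r s with
  | zero =>
    intro s' hs'
    simp only [samplingStage, List.replicate_zero, List.flatten_nil, runLaw,
      PMF.mem_support_pure_iff] at hs'
    simpa [hs'] using h
  | succ m ih =>
    intro s' hs'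
    rw [samplingStage, List.replicate_succ, List.flatten_cons, runLaw_append,
      PMF.mem_support_bind_iff] at hs'
    obtain ⟨s₁, h₁, hs'⟩ := hs'
    have := ih (mul_nonneg hr γ.coe_nonneg) (h.run_samplingPhase hr n p s₁ h₁) s' hs'
    rwa [mul_assoc, ← pow_succ'] at this

theorem expect_samplingStage_le {r : ℝ} (hr : 0 ≤ r) {γ : ℝ≥0} (hγ : 1 ≤ γ) {n : ℕ}
    (hn : (N.maxDegree : ℝ≥0) + 1 ≤ γ ^ n) (m : ℕ) {s : PackingState V}
    (h : s.IsUniformPacking N r) :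
    (runLaw N (samplingStage γ (N.maxDegree + 1)⁻¹ n m) s).expect
        (fun s' => ENNReal.ofReal (N.weightOf s'.joined))
      ≤ ENNReal.ofReal (N.weightOf s.joined + m * (γ * (γ + 1)) * N.opt) := by
  induction m generalizing r s with
  | zero => simp [samplingStage, runLaw, PMF.expect_pure]
  | succ m ih =>
    rw [samplingStage, List.replicate_succ, List.flatten_cons, runLaw_append, PMF.expect_bind]
    refine (PMF.expect_mono_of_support _ fun s₁ h₁ =>
      ih (mul_nonneg hr γ.coe_nonneg) (h.run_samplingPhase hr n _ s₁ h₁)).trans ?_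
    have e : ∀ s₁ : PackingState V,
        ENNReal.ofReal (N.weightOf s₁.joined + m * (γ * (γ + 1)) * N.opt)
          = ENNReal.ofReal (N.weightOf s₁.joined)
            + ENNReal.ofReal (m * (γ * (γ + 1)) * N.opt) :=
      fun s₁ => ENNReal.ofReal_add (Nat.cast_nonneg _) (by positivity)
    simp only [e]
    rw [PMF.expect_add_const]
    refine (add_le_add_left (expect_samplingPhase_le_add_opt hr hγ hn h) _).trans_eq ?_
    rw [← ENNReal.ofReal_add (Nat.cast_nonneg _) (by positivity),
      ← ENNReal.ofReal_add (by positivity) (by positivity)]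
    congr 1
    push_cast
    ring

end PackingState

end samplingStage

/-! ### Simulation by message passing. -/

section simulation

open Classical

variable {V : Type}

/-! ### The distributed implementation -/

/-- What a node knows between two iterations: its own data, and the packing values and the
domination status of its neighbors, indexed by their identifiers. -/
structure LocalView where
  weight : ℕ
  neighbors : Finset ℕ
  joined : Bool
  dominated : Bool
  value : ℝ
  neighborValue : ℕ → ℝ
  neighborDominated : ℕ → Bool

/-- The load that a node computes from its view. -/
noncomputable def LocalView.load (all : Bool) (x : LocalView) : ℝ :=
  (if all = true ∨ x.dominated = false then x.value else 0)
    + ∑ j ∈ x.neighbors, if all = true ∨ x.neighborDominated j = false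
        then x.neighborValue j else 0

/-- The state of a node: at the beginning; when it knows the minimum weight in its closed
neighborhood; before an iteration; when it has decided whether to join; and when it knows whether
it is dominated. The lists contain the iterations that are left. -/
inductive NodeState
  | initial (i : LocalInput)
  | informed (i : LocalInput) (τ : ℕ)
  | ready (L : List IterationParams) (x : LocalView)
  | drawn (a : IterationParams) (L : List IterationParams) (x : LocalView)
  | announced (a : IterationParams) (L : List IterationParams) (x : LocalView)

namespace NodeState

/-- The number with binary digits `l`. -/
noncomputable def decode : List Bool → ℕ := Function.invFun Nat.bits

theorem bits_injective : Function.Injective Nat.bits := by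
  intro m
  induction m using Nat.binaryRec' with
  | zero =>
    intro n h
    have := congrArg List.length h
    simp only [Nat.size_eq_bits_len, Nat.size_zero] at this
    exact (Nat.size_eq_zero.1 this.symm).symm
  | bit b m hb ih =>
    intro n
    induction n using Nat.binaryRec' with
    | zero =>
      intro h
      have := congrArg List.length h
      simp only [Nat.size_eq_bits_len, Nat.size_zero] at this
      exact Nat.size_eq_zero.1 this
    | bit c n hc _ =>
      intro h
      rw [Nat.bits_append_bit _ _ hb, Nat.bits_append_bit _ _ hc, List.cons.injEq] at h
      rw [h.1, ih h.2]

theorem decode_bits (n : ℕ) : decode n.bits = n :=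
  Function.leftInverse_invFun bits_injective n

theorem decode_nil : decode [] = 0 := by simpa using decode_bits 0

/-- The message sent to each neighbor. -/
noncomputable def message : NodeState → List Bool
  | initial i => i.weight.bits
  | informed _ τ => τ.bits
  | ready _ _ => []
  | drawn _ _ x => [x.joined]
  | announced _ _ x => [x.dominated]

/-- The law of the next state of a node that receives the messages `m`. The initial packing values
are `r` times the minimum weight in the closed neighborhood, and `S` is the schedule. -/
noncomputable def step (r : ℝ) (S : List IterationParams) :
    NodeState → (ℕ → List Bool) → PMF NodeState
  | initial i, m => PMF.pure (informed i (i.neighbors.fold min i.weight fun j => decode (m j)))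
  | informed i τ, m => PMF.pure (ready S
      { weight := i.weight
        neighbors := i.neighbors
        joined := false
        dominated := false
        value := r * τ
        neighborValue := fun j => r * decode (m j)
        neighborDominated := fun _ => false })
  | ready [] x, _ => PMF.pure (ready [] x)
  | ready (a :: L) x, _ =>
      (if (x.weight : ℝ) ≤ a.threshold * x.load a.countAll then coin a.prob
        else PMF.pure false).map fun b => drawn a L { x with joined := x.joined || b }
  | drawn a L x, m => PMF.pure (announced a L
      { x with dominated := x.joined || decide (∃ j ∈ x.neighbors, m j = [true]) })
  | announced a L x, m => PMF.pure (ready L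
      { x with
        value := if x.dominated = true then x.value else a.factor * x.value
        neighborValue := fun j =>
          if m j = [true] then x.neighborValue j else a.factor * x.neighborValue j
        neighborDominated := fun j => decide (m j = [true]) })

/-- Whether the node has joined. -/
def hasJoined : NodeState → Bool
  | ready _ x => x.joined
  | _ => false

/-- The numbers that are still to be sent are at most `w`. -/
def IsBounded (w : ℕ) : NodeState → Prop
  | initial i => i.weight ≤ w
  | informed _ τ => τ ≤ w
  | _ => True

theorem IsBounded.step {w : ℕ} {r : ℝ} {S : List IterationParams} {x y : NodeState}
    {m : ℕ → List Bool} (h : x.IsBounded w) (hy : y ∈ (x.step r S m).support) :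
    y.IsBounded w := by
  match x with
  | initial i =>
    obtain rfl := (PMF.mem_support_pure_iff _ _).1 hy
    exact (Finset.fold_min_le _).2 (Or.inl h)
  | informed i τ =>
    obtain rfl := (PMF.mem_support_pure_iff _ _).1 hy
    trivial
  | ready [] x =>
    obtain rfl := (PMF.mem_support_pure_iff _ _).1 hy
    trivial
  | ready (a :: L) x =>
    obtain ⟨b, -, rfl⟩ := (PMF.mem_support_map_iff _ _ _).1 hy
    trivial
  | drawn a L x =>
    obtain rfl := (PMF.mem_support_pure_iff _ _).1 hy
    trivial
  | announced a L x =>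
    obtain rfl := (PMF.mem_support_pure_iff _ _).1 hy
    trivial

/-- The extra `1` pays for the one-bit join and domination messages even when `w = 0`. -/
theorem IsBounded.length_message_le {w : ℕ} {x : NodeState} (h : x.IsBounded w) :
    x.message.length ≤ w.size + 1 := by
  match x with
  | initial i =>
    rw [message, Nat.size_eq_bits_len]
    exact (Nat.size_le_size h).trans (Nat.le_succ _)
  | informed i τ =>
    rw [message, Nat.size_eq_bits_len]
    exact (Nat.size_le_size h).trans (Nat.le_succ _)
  | ready L x => simp [message]
  | drawn a L x => simp [message]
  | announced a L x => simp [message]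

end NodeState

namespace Network

variable (N : Network V)

/-- The function on identifiers that is given by `g` on the neighbors of `v`, and is `d`
elsewhere. -/
noncomputable def onNeighbors {β : Type} (v : V) (d : β) (g : V → β) : ℕ → β :=
  Function.extend N.ident (fun u => if N.graph.Adj u v then g u else d) fun _ => d

variable {N}

theorem onNeighbors_ident {β : Type} {u v : V} (h : N.graph.Adj u v) (d : β) (g : V → β) :
    N.onNeighbors v d g (N.ident u) = g u := by
  rw [onNeighbors, N.ident_injective.extend_apply, if_pos h]

/-- Views are compared as functions on all of `ℕ`, so the defaults off the neighborhood have to be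
carried along. -/
theorem onNeighbors_map₂ {β γ δ : Type} (F : β → γ → δ) (v : V) (d : β) (e : γ) (g : V → β)
    (h : V → γ) (j : ℕ) :
    F (N.onNeighbors v d g j) (N.onNeighbors v e h j)
      = N.onNeighbors v (F d e) (fun u => F (g u) (h u)) j := by
  by_cases hj : ∃ u, N.ident u = j
  · obtain ⟨u, rfl⟩ := hj
    simp only [onNeighbors, N.ident_injective.extend_apply]
    split_ifs <;> rfl
  · simp only [onNeighbors, Function.extend_apply' _ _ _ hj]

theorem onNeighbors_map {β γ : Type} (F : β → γ) (v : V) (d : β) (g : V → β) (j : ℕ) :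
    F (N.onNeighbors v d g j) = N.onNeighbors v (F d) (fun u => F (g u)) j :=
  onNeighbors_map₂ (fun b (_ : Unit) => F b) v d () g (fun _ => ()) j

theorem onNeighbors_const {β : Type} (v : V) (d : β) (j : ℕ) :
    N.onNeighbors v d (fun _ => d) j = d := by
  rw [onNeighbors]
  by_cases hj : ∃ u, N.ident u = j
  · obtain ⟨u, rfl⟩ := hj
    simp [N.ident_injective.extend_apply]
  · rw [Function.extend_apply' _ _ _ hj]

variable [Fintype V]

theorem sum_neighborIdents (f : ℕ → ℝ) (v : V) :
    ∑ j ∈ N.neighborIdents v, f j = ∑ u ∈ N.graph.neighborFinset v, f (N.ident u) :=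
  Finset.sum_image fun _ _ _ _ h => N.ident_injective h

theorem exists_mem_neighborIdents {p : ℕ → Prop} {v : V} :
    (∃ j ∈ N.neighborIdents v, p j) ↔ ∃ u, N.graph.Adj v u ∧ p (N.ident u) := by
  simp [neighborIdents]

end Network

variable [Fintype V]

namespace PackingState

/-- What `v` knows of the state `s` of the process. -/
noncomputable def localView (N : Network V) (s : PackingState V) (v : V) : LocalView where
  weight := N.weight v
  neighbors := N.neighborIdents v
  joined := decide (v ∈ s.joined)
  dominated := decide (v ∉ N.undominated s.joined)
  value := s.value v
  neighborValue := N.onNeighbors v 0 s.value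
  neighborDominated := N.onNeighbors v false fun u => decide (u ∉ N.undominated s.joined)

theorem load_localView (N : Network V) (all : Bool) (s : PackingState V) (v : V) :
    (s.localView N v).load all = s.load N all v := by
  rw [load, Finset.sum_filter, N.sum_closedNbhd, LocalView.load]
  simp only [localView, N.sum_neighborIdents]
  congr 1
  · simp
  · refine Finset.sum_congr rfl fun u hu => ?_
    have hadj : N.graph.Adj u v := by simpa [N.graph.adj_comm] using hu
    simp only [Network.onNeighbors_ident hadj]
    simp

end PackingState

/-- The distributed algorithm that runs the primal-dual process with schedule `S`. -/
noncomputable def primalDualAlgorithm (r : ℝ) (S : List IterationParams) :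
    DistributedAlgorithm where
  State := NodeState
  -- Two rounds spread the weights and their neighborhood minima. An iteration takes a silent round
  -- for the coins, then one for join bits and one for domination bits.
  rounds := 2 + 3 * S.length
  init i := PMF.pure (NodeState.initial i)
  send s _ := s.message
  step := NodeState.step r S
  output := NodeState.hasJoined

namespace primalDualAlgorithm

variable {r : ℝ} {S : List IterationParams} {N : Network V}

/-- The law of the states after one round that starts in the states `s`. -/
noncomputable def roundLaw (r : ℝ) (S : List IterationParams) (N : Network V)
    (s : V → NodeState) : PMF (V → NodeState) :=
  independentChoices fun v => (s v).step r S (N.onNeighbors v [] fun u => (s u).message)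

/-- The law of the states after several rounds that start in the states `s`. -/
noncomputable def roundsLaw (r : ℝ) (S : List IterationParams) (N : Network V) :
    ℕ → (V → NodeState) → PMF (V → NodeState)
  | 0, s => PMF.pure s
  | n + 1, s => (roundLaw r S N s).bind (roundsLaw r S N n)

/-- The law of the states after `k` rounds. -/
noncomputable def nodeStateLaw (r : ℝ) (S : List IterationParams) (N : Network V) (k : ℕ) :
    PMF (V → NodeState) :=
  (primalDualAlgorithm r S).stateLaw N k

theorem nodeStateLaw_zero : nodeStateLaw r S N 0
    = PMF.pure fun v => NodeState.initial (DistributedAlgorithm.localInput N v) :=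
  independentChoices_pure _

theorem nodeStateLaw_succ (k : ℕ) :
    nodeStateLaw r S N (k + 1) = (nodeStateLaw r S N k).bind (roundLaw r S N) := rfl

/-- The model appends rounds at the end, whereas induction on the schedule peels them off at the
front. -/
theorem nodeStateLaw_add (k n : ℕ) :
    nodeStateLaw r S N (k + n) = (nodeStateLaw r S N k).bind (roundsLaw r S N n) := by
  induction n generalizing k with
  | zero =>
    simp only [Nat.add_zero]
    exact (PMF.bind_pure _).symm
  | succ n ih =>
    rw [← Nat.succ_add_eq_add_succ, ih (k + 1), nodeStateLaw_succ, PMF.bind_bind]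
    rfl

/-- The state of the process at the beginning. -/
noncomputable def initialPacking (N : Network V) (r : ℝ) : PackingState V :=
  ⟨∅, fun v => r * N.minWeight v⟩

theorem roundLaw_of_pure {s t : V → NodeState}
    (h : ∀ v, (s v).step r S (N.onNeighbors v [] fun u => (s u).message) = PMF.pure (t v)) :
    roundLaw r S N s = PMF.pure t := by
  rw [roundLaw, ← independentChoices_pure]
  exact congrArg independentChoices (funext h)

theorem nodeStateLaw_two :
    nodeStateLaw r S N 2
      = PMF.pure fun v => NodeState.ready S ((initialPacking N r).localView N v) := by
  have h1 : nodeStateLaw r S N 1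
      = PMF.pure fun v => NodeState.informed (DistributedAlgorithm.localInput N v)
          (N.minWeight v) := by
    rw [nodeStateLaw_succ, nodeStateLaw_zero, PMF.pure_bind]
    refine roundLaw_of_pure fun v => ?_
    simp only [NodeState.step, DistributedAlgorithm.localInput, Network.neighborIdents]
    rw [Finset.fold_image fun _ _ _ _ h => N.ident_injective h, Network.minWeight]
    congr 2
    refine Finset.fold_congr fun u hu => ?_
    have hadj : N.graph.Adj u v := by simpa [N.graph.adj_comm] using hu
    rw [Function.comp_apply, Network.onNeighbors_ident hadj]
    exact NodeState.decode_bits _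
  rw [nodeStateLaw_succ, h1, PMF.pure_bind]
  refine roundLaw_of_pure fun v => ?_
  have hund : ∀ u, decide (u ∉ N.undominated (initialPacking N r).joined) = false := by
    simp [Network.mem_undominated, initialPacking]
  simp only [NodeState.step, DistributedAlgorithm.localInput, PackingState.localView, hund]
  congr 3
  · funext j
    refine (Network.onNeighbors_map (fun l => r * (NodeState.decode l : ℝ)) v [] _ j).trans ?_
    simp [NodeState.message, NodeState.decode_bits, NodeState.decode_nil, initialPacking]
  · funext j
    exact (Network.onNeighbors_const v false j).symm

/-- Three rounds carry exact local views of one state of the process to exact local views of the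
next. Domination bits suffice to update the stored values of neighbors. -/
theorem roundsLaw_ready (L : List IterationParams) (s : PackingState V) :
    roundsLaw r S N (3 * L.length)
        (fun v => NodeState.ready L (s.localView N v))
      = (s.runLaw N L).map fun s' v => NodeState.ready [] (s'.localView N v) := by
  induction L generalizing s with
  | nil => simp only [List.length_nil, mul_zero, roundsLaw, PackingState.runLaw, PMF.pure_map]
  | cons a L ih =>
    have h1 : roundLaw r S N
          (fun v => NodeState.ready (a :: L) (s.localView N v))
        = (independentChoices (s.joinLaw N a)).map fun f v => NodeState.drawn a L
            { s.localView N v with joined := decide (v ∈ s.joined) || f v } := by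
      rw [← independentChoices_map (s.joinLaw N a) fun v b => NodeState.drawn a L
            { s.localView N v with joined := decide (v ∈ s.joined) || b }]
      refine congrArg independentChoices (funext fun v => ?_)
      simp only [NodeState.step, PackingState.load_localView]
      congr 1
      simp [PackingState.joinLaw, PackingState.candidates, PackingState.localView]
    have h2 : ∀ f : V → Bool, roundLaw r S N
          (fun v => NodeState.drawn a L
            { s.localView N v with joined := decide (v ∈ s.joined) || f v })
        = PMF.pure fun v => NodeState.announced a L
            { s.localView N v with
              joined := decide (v ∈ s.joined) || f v
              dominated := decide (v ∉ N.undominated (s.update N a.factor f).joined) } := by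
      intro f
      refine roundLaw_of_pure fun v => ?_
      simp only [NodeState.step, NodeState.message, PackingState.localView,
        Network.exists_mem_neighborIdents]
      congr 3
      rw [Bool.eq_iff_iff]
      simp only [Bool.or_eq_true, decide_eq_true_eq, Network.mem_undominated, not_forall,
        not_not, Network.mem_closedNbhd, PackingState.update, Finset.mem_union,
        Finset.mem_filter, Finset.mem_univ, true_and]
      constructor
      · rintro (h | ⟨u, hu, h⟩)
        · exact ⟨v, Or.inl rfl, h⟩
        · rw [Network.onNeighbors_ident hu.symm] at h
          exact ⟨u, Or.inr hu, by simpa using h⟩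
      · rintro ⟨u, rfl | hu, h⟩
        · exact Or.inl h
        · refine Or.inr ⟨u, hu, ?_⟩
          rw [Network.onNeighbors_ident hu.symm]
          simpa using h
    have h3 : ∀ f : V → Bool, roundLaw r S N
          (fun v => NodeState.announced a L
            { s.localView N v with
              joined := decide (v ∈ s.joined) || f v
              dominated := decide (v ∉ N.undominated (s.update N a.factor f).joined) })
        = PMF.pure fun v => NodeState.ready L ((s.update N a.factor f).localView N v) := by
      intro f
      refine roundLaw_of_pure fun v => ?_
      simp only [NodeState.step, PackingState.localView]
      congr 3
      · simp [PackingState.update]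
      · by_cases hv : v ∈ N.undominated (s.update N a.factor f).joined
        · simp [hv, PackingState.value_update_of_mem N hv]
        · simp [hv, PackingState.value_update_of_notMem N hv]
      · funext j
        -- Off the neighborhood the message is `[]` and the value `0`, which multiplication by the
        -- factor preserves.
        refine (Network.onNeighbors_map₂ (fun (l : List Bool) (x : ℝ) =>
          if l = [true] then x else a.factor * x) v [] 0 _ _ j).trans ?_
        congr 1
        · simp
        · funext u
          by_cases hu : u ∈ N.undominated (s.update N a.factor f).joined
          · simp [NodeState.message, hu, PackingState.value_update_of_mem N hu]
          · simp [NodeState.message, hu, PackingState.value_update_of_notMem N hu]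
      · funext j
        refine (Network.onNeighbors_map (fun l : List Bool => decide (l = [true]))
          v [] _ j).trans ?_
        simp [NodeState.message]
    rw [List.length_cons, Nat.mul_succ]
    rw [roundsLaw, h1, PackingState.runLaw, PackingState.iterationLaw, PMF.bind_map, PMF.bind_map,
      PMF.map_bind]
    congr 1
    funext f
    change (roundLaw r S N _).bind (roundsLaw r S N (3 * L.length + 1)) = _
    refine (congrArg (PMF.bind · _) (h2 f)).trans ?_
    rw [PMF.pure_bind, roundsLaw]
    refine (congrArg (PMF.bind · _) (h3 f)).trans ?_
    rw [PMF.pure_bind]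
    exact ih _

theorem nodeStateLaw_rounds :
    nodeStateLaw r S N (2 + 3 * S.length)
      = ((initialPacking N r).runLaw N S).map
          fun s' v => NodeState.ready [] (s'.localView N v) := by
  rw [nodeStateLaw_add, nodeStateLaw_two, PMF.pure_bind, roundsLaw_ready]

theorem outputLaw_eq :
    (primalDualAlgorithm r S).outputLaw N
      = ((initialPacking N r).runLaw N S).map PackingState.joined := by
  change (nodeStateLaw r S N (2 + 3 * S.length)).map
    (fun s => Finset.univ.filter fun v => (s v).hasJoined = true) = _
  rw [nodeStateLaw_rounds, PMF.map_comp]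
  congr 1
  funext s
  ext v
  simp [NodeState.hasJoined, PackingState.localView]

theorem isBounded_of_mem_support {w : ℕ} (hw : ∀ v, N.weight v ≤ w) (k : ℕ) :
    ∀ s ∈ (nodeStateLaw r S N k).support, ∀ v, NodeState.IsBounded w (s v) := by
  induction k with
  | zero =>
    intro s hs v
    rw [nodeStateLaw_zero, PMF.mem_support_pure_iff] at hs
    rw [hs]
    exact hw v
  | succ k ih =>
    intro s hs v
    obtain ⟨s₀, hs₀, hs⟩ := (PMF.mem_support_bind_iff _ _ _).1 hs
    exact (ih s₀ hs₀ v).step (mem_support_independentChoices.1 hs v)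

theorem size_pow_add_one_le {n : ℕ} (hn : 2 ≤ n) (c : ℕ) :
    (((n ^ c).size + 1 : ℕ) : ℝ) ≤ 2 * (c + 2) * Real.log n := by
  have hlog : Real.log 2 ≤ Real.log n :=
    Real.log_le_log (by norm_num) (by exact_mod_cast hn)
  have hlog2 := Real.log_two_gt_d9
  have hsize : ((n ^ c).size : ℝ) * Real.log 2 ≤ (c + 1) * Real.log n := by
    obtain ⟨m, hm⟩ : ∃ m, (n ^ c).size = m + 1 :=
      Nat.exists_eq_succ_of_ne_zero (Nat.size_pos.2 (by positivity)).ne'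
    have h2 : 2 ^ m ≤ n ^ c := Nat.lt_size.1 (by omega)
    have h3 : (m : ℝ) * Real.log 2 ≤ c * Real.log n := by
      rw [← Real.log_pow, ← Real.log_pow]
      exact Real.log_le_log (by positivity) (by exact_mod_cast h2)
    rw [hm]
    push_cast
    linarith
  push_cast
  have h1 : (0 : ℝ) ≤ (n ^ c).size := Nat.cast_nonneg _
  nlinarith

theorem messageBitsAtMost {c : ℕ} (h : N.PolyBounded c) :
    (primalDualAlgorithm r S).MessageBitsAtMost N
      (2 * (c + 2) * Real.log (Fintype.card V)) := by
  intro k _ s hs u v huv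
  -- Messages only travel along edges, so there are two nodes and `log n` is bounded away from `0`.
  have hn : 2 ≤ Fintype.card V :=
    Fintype.one_lt_card_iff.2 ⟨u, v, huv.ne⟩
  refine le_trans ?_ (size_pow_add_one_le hn c)
  exact_mod_cast (isBounded_of_mem_support (fun v => (h v).2) k s hs u).length_message_le

theorem expectedWeight_le {W : ℝ} (hW : 0 ≤ W)
    (h : ((initialPacking N r).runLaw N S).expect
      (fun s => ENNReal.ofReal (N.weightOf s.joined)) ≤ ENNReal.ofReal W) :
    (primalDualAlgorithm r S).expectedWeight N ≤ W := by
  rw [← PMF.expect_map _ PackingState.joined fun D => ENNReal.ofReal (N.weightOf D),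
    ← outputLaw_eq, PMF.expect, tsum_fintype] at h
  rw [DistributedAlgorithm.expectedWeight, ← ENNReal.ofReal_le_ofReal_iff hW,
    ENNReal.ofReal_sum_of_nonneg fun D _ =>
      mul_nonneg ENNReal.toReal_nonneg (Nat.cast_nonneg _)]
  refine le_trans (Finset.sum_le_sum fun D _ => ?_) h
  rw [ENNReal.ofReal_mul ENNReal.toReal_nonneg, ENNReal.ofReal_toReal (PMF.apply_ne_top _ _)]

end primalDualAlgorithm

end simulation

/-! ### Choice of parameters. -/

section schedule

open NNReal PackingState

/-- The deterministic stage followed by the sampling stage. -/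
noncomputable def dominatingSetSchedule (ε : ℝ) (γ : ℝ≥0) (Δ K J M : ℕ) :
    List IterationParams :=
  List.replicate K (tightIteration ε) ++ samplingStage γ ((Δ : ℝ≥0) + 1)⁻¹ J M

theorem length_samplingPhase (γ p : ℝ≥0) (n : ℕ) : (samplingPhase γ p n).length = n + 1 := by
  induction n generalizing p with
  | zero => rfl
  | succ n ih => rw [samplingPhase, List.length_cons, ih]

theorem length_dominatingSetSchedule (ε : ℝ) (γ : ℝ≥0) (Δ K J M : ℕ) :
    (dominatingSetSchedule ε γ Δ K J M).length = K + M * (J + 1) := by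
  simp [dominatingSetSchedule, samplingStage, length_samplingPhase]

/-- Of the three growth conditions, `hK` makes the initial packing feasible, `hJ` lets the
probabilities reach `1`, and `hM` forces domination at the end. The deterministic cost bound holds
in every outcome, so the expected sampling cost is simply added. -/
theorem approximatesMDS_primalDualAlgorithm {α Δ K J M : ℕ} {ε l : ℝ} {γ : ℝ≥0}
    (hε : 0 ≤ ε) (hε' : ε ≤ 1 / 4) (hγ : 1 ≤ γ) (hl : l * (α + 1) = ε)
    (hK : (Δ : ℝ) + 1 ≤ (1 + ε) ^ K) (hJ : (Δ : ℝ≥0) + 1 ≤ γ ^ J) (hM : 1 < l * (γ : ℝ) ^ M) :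
    (primalDualAlgorithm (l / (1 + ε) ^ K)
      (dominatingSetSchedule ε γ Δ K J M)).ApproximatesMDS (fun c => 2 * (c + 2)) α Δ
        (α * (1 + 4 * ε) + M * (γ * (γ + 1))) := by
  intro V _ N c hc hα hΔ
  have hK0 : 0 < (1 + ε) ^ K := by positivity
  have hα0 : (0 : ℝ) ≤ α := Nat.cast_nonneg _
  have hl0 : 0 ≤ l := by
    by_contra! h
    nlinarith
  have hl1 : l ≤ 1 := by nlinarith
  have hr : 0 ≤ l / (1 + ε) ^ K := by positivity
  have h0 : (primalDualAlgorithm.initialPacking N (l / (1 + ε) ^ K)).IsTightPacking N ε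
      (l / (1 + ε) ^ K) := by
    refine isTightPacking_initial hr ?_
    rw [hΔ, div_mul_eq_mul_div, div_le_one hK0]
    refine le_trans ?_ hK
    exact mul_le_of_le_one_left (by positivity) hl1
  have h1 : ∀ s ∈ (runLaw N (List.replicate K (tightIteration ε))
      (primalDualAlgorithm.initialPacking N (l / (1 + ε) ^ K))).support,
      s.IsTightPacking N ε l := by
    have := h0.run hε K
    rwa [div_mul_cancel₀ _ hK0.ne'] at this
  refine ⟨primalDualAlgorithm.messageBitsAtMost hc, fun D hD => ?_, ?_⟩
  · rw [primalDualAlgorithm.outputLaw_eq, PMF.mem_support_map_iff] at hD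
    obtain ⟨s, hs, rfl⟩ := hD
    rw [dominatingSetSchedule, runLaw_append, PMF.mem_support_bind_iff] at hs
    obtain ⟨s₁, hs₁, hs⟩ := hs
    exact N.isDominatingSet_of_undominated_eq_empty
      (((h1 s₁ hs₁).isUniformPacking.run_samplingStage hl0 M s hs).undominated_eq_empty hM)
  · refine primalDualAlgorithm.expectedWeight_le (by positivity) ?_
    rw [dominatingSetSchedule, runLaw_append, PMF.expect_bind]
    refine PMF.expect_le_of_support _ fun s hs => ?_
    subst hΔ
    refine (expect_samplingStage_le hl0 hγ hJ M (h1 s hs).isUniformPacking).trans ?_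
    refine ENNReal.ofReal_le_ofReal ?_
    rw [add_mul]
    exact add_le_add_left ((h1 s hs).weightOf_le hα hε hε' hl0 hl.le) _

theorem natCast_add_one_le_exp (Δ : ℕ) :
    (Δ : ℝ) + 1 ≤ Real.exp (2 * Real.log (max (Δ : ℝ) 2)) := by
  have h : (0 : ℝ) < max (Δ : ℝ) 2 := lt_max_of_lt_right two_pos
  rw [two_mul, Real.exp_add, Real.exp_log h]
  have h1 := le_max_left (Δ : ℝ) 2
  have h2 := le_max_right (Δ : ℝ) 2
  nlinarith

theorem half_le_log_max (Δ : ℕ) : 1 / 2 ≤ Real.log (max (Δ : ℝ) 2) := by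
  have h1 := Real.log_two_gt_d9
  have h2 : Real.log 2 ≤ Real.log (max (Δ : ℝ) 2) :=
    Real.log_le_log two_pos (le_max_right _ _)
  linarith

theorem exists_pow_ge (Δ : ℕ) {g : ℝ} (hg : 1 < g) :
    ∃ n : ℕ, (Δ : ℝ) + 1 ≤ g ^ n ∧ (n : ℝ) ≤ 1 + 2 * Real.log (max (Δ : ℝ) 2) / Real.log g := by
  have hlog : 0 < Real.log g := Real.log_pos hg
  have hL := half_le_log_max Δ
  refine ⟨⌈2 * Real.log (max (Δ : ℝ) 2) / Real.log g⌉₊, ?_, ?_⟩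
  · refine (natCast_add_one_le_exp Δ).trans ?_
    rw [← Real.exp_log (show 0 < g by linarith), ← Real.exp_nat_mul, Real.exp_log (by linarith)]
    refine Real.exp_le_exp.2 ?_
    rw [← div_le_iff₀ hlog]
    exact Nat.le_ceil _
  · rw [add_comm]
    exact (Nat.ceil_lt_add_one (by positivity)).le

theorem exists_pow_gt {y g : ℝ} (hy : 1 ≤ y) (hg : 1 < g) :
    ∃ n : ℕ, y < g ^ n ∧ (n : ℝ) ≤ 1 + Real.log y / Real.log g := by
  have hlog : 0 < Real.log g := Real.log_pos hg
  have hlogy : 0 ≤ Real.log y := Real.log_nonneg hy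
  refine ⟨⌊Real.log y / Real.log g⌋₊ + 1, ?_, ?_⟩
  · rw [← Real.log_lt_log_iff (by linarith) (by positivity), Real.log_pow, ← div_lt_iff₀ hlog]
    exact_mod_cast Nat.lt_floor_add_one _
  · push_cast
    rw [add_comm]
    gcongr
    exact Nat.floor_le (by positivity)

/-- For `t ≥ √α`, `γ = 2` needs `O(log α)` phases, and `log α` is at most both `2 * t` and `α / t`.
For `t ≤ √α`, `γ = 2 * α ^ (1/4)` needs at most 25 phases, each of cost `O(√α)`, and `√α ≤ α / t`.
-/
theorem exists_samplingStage_params {α : ℕ} (hα : 2 ≤ α) (Δ : ℕ) {t y : ℝ} (ht : 1 ≤ t)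
    (ht' : t ≤ (α : ℝ) / Real.log α) (hy : 1 ≤ y) (hy' : y ≤ (α : ℝ) ^ 6) :
    ∃ (γ : ℝ≥0) (J M : ℕ), 1 ≤ γ ∧ (Δ : ℝ≥0) + 1 ≤ γ ^ J ∧ y < (γ : ℝ) ^ M ∧
      (M : ℝ) * (J + 1) ≤ 224 * (t * Real.log (max (Δ : ℝ) 2)) ∧
      M * ((γ : ℝ) * (γ + 1)) ≤ 200 * (α / t) := by
  have hα' : (2 : ℝ) ≤ α := by exact_mod_cast hα
  set L := Real.log (max (Δ : ℝ) 2)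
  have hL : 1 / 2 ≤ L := half_le_log_max Δ
  have hlog2 := Real.log_two_gt_d9
  have hlα : Real.log 2 ≤ Real.log α := Real.log_le_log two_pos hα'
  have hly : Real.log y ≤ 6 * Real.log α := by
    have := Real.log_le_log (by linarith) hy'
    rwa [Real.log_pow] at this
  have hs : √(α : ℝ) * √(α : ℝ) = α := Real.mul_self_sqrt (by positivity)
  have hs1 : 1 ≤ √(α : ℝ) := Real.one_le_sqrt.2 (by linarith)
  have key : ∀ g : ℝ, 2 ≤ g → ∃ J M : ℕ, (Δ : ℝ) + 1 ≤ g ^ J ∧ y < g ^ M ∧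
      (J : ℝ) + 1 ≤ 8 * L ∧ (M : ℝ) ≤ 1 + 6 * Real.log α / Real.log g := by
    intro g hg
    have hlg : 1 / 2 ≤ Real.log g := by
      have := Real.log_le_log two_pos hg
      linarith
    obtain ⟨J, hJ, hJ'⟩ := exists_pow_ge Δ (g := g) (by linarith)
    obtain ⟨M, hM, hM'⟩ := exists_pow_gt hy (g := g) (by linarith)
    refine ⟨J, M, hJ, hM, ?_, hM'.trans ?_⟩
    · have : 2 * L / Real.log g ≤ 4 * L := by
        rw [div_le_iff₀ (by linarith)]
        nlinarith
      linarith
    · gcongr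
  rcases le_total (√(α : ℝ)) t with hcase | hcase
  · obtain ⟨J, M, hJ, hM, hJ', hM'⟩ := key 2 le_rfl
    refine ⟨2, J, M, one_le_two, ?_, by simpa using hM, ?_, ?_⟩
    · exact_mod_cast hJ
    all_goals
      have hM14 : (M : ℝ) ≤ 14 * Real.log α := by
        have : 6 * Real.log α / Real.log 2 ≤ 12 * Real.log α := by
          rw [div_le_iff₀ (by linarith)]
          nlinarith
        linarith
    · have h1 : Real.log α ≤ 2 * t := by
        have h2 := Real.log_le_sub_one_of_pos (show 0 < √(α : ℝ) by linarith)
        have h3 : Real.log α = 2 * Real.log √(α : ℝ) := by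
          rw [Real.log_sqrt (by positivity)]; ring
        linarith
      calc (M : ℝ) * (J + 1) ≤ (14 * (2 * t)) * (8 * L) := by
            gcongr
            linarith
        _ = 224 * (t * L) := by ring
    · have h1 : Real.log α ≤ α / t := by
        rw [le_div_iff₀ (by linarith)]
        rw [le_div_iff₀ (by linarith)] at ht'
        linarith
      have h2 : 0 ≤ (α : ℝ) / t := by positivity
      rw [NNReal.coe_ofNat]
      linarith
  · set q := √√(α : ℝ) with hq
    have hqq : q * q = √(α : ℝ) := Real.mul_self_sqrt (by positivity)
    have hq1 : 1 ≤ q := Real.one_le_sqrt.2 hs1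
    obtain ⟨J, M, hJ, hM, hJ', hM'⟩ := key (2 * q) (by linarith)
    obtain ⟨g, hg⟩ : ∃ g : ℝ≥0, (g : ℝ) = 2 * q :=
      ⟨Real.toNNReal (2 * q), Real.coe_toNNReal _ (by linarith)⟩
    refine ⟨g, J, M, ?_, ?_, by rwa [hg], ?_, ?_⟩
    · rw [← NNReal.coe_le_coe, hg, NNReal.coe_one]
      linarith
    · rw [← NNReal.coe_le_coe]
      push_cast
      rwa [hg]
    all_goals
      have hM25 : (M : ℝ) ≤ 25 := by
        have h1 : Real.log α ≤ 4 * Real.log (2 * q) := by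
          have : Real.log q = Real.log α / 4 := by
            rw [hq, Real.log_sqrt (by positivity), Real.log_sqrt (by positivity)]; ring
          rw [Real.log_mul two_ne_zero (by linarith)]
          linarith
        have : 6 * Real.log α / Real.log (2 * q) ≤ 24 := by
          rw [div_le_iff₀ (Real.log_pos (by linarith))]
          linarith
        linarith
    · calc (M : ℝ) * (J + 1) ≤ 25 * (8 * L) := by gcongr
        _ ≤ 224 * (t * L) := by nlinarith
    · have h1 : √(α : ℝ) ≤ α / t := by
        rw [le_div_iff₀ (by linarith)]
        nlinarith
      rw [hg]
      calc (M : ℝ) * (2 * q * (2 * q + 1)) ≤ 25 * (8 * (q * q)) :=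
            mul_le_mul hM25 (by nlinarith) (by positivity) (by norm_num)
        _ ≤ _ := by rw [hqq]; linarith

theorem exists_approximatesMDS {α : ℕ} (hα : 2 ≤ α) (Δ : ℕ) {t : ℝ} (ht : 1 ≤ t)
    (ht' : t ≤ (α : ℝ) / Real.log α) {C : ℝ} (hC : 201 ≤ C) :
    ∃ A : DistributedAlgorithm, (A.rounds : ℝ) ≤ 712 * (t * Real.log (max (Δ : ℝ) 2)) ∧
      A.ApproximatesMDS (fun c => 2 * (c + 2)) α Δ (α + C * (α / t)) := by
  have hα' : (2 : ℝ) ≤ α := by exact_mod_cast hα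
  have ht0 : 0 < t := by linarith
  have hL := half_le_log_max Δ
  have hlog2 := Real.log_two_gt_d9
  have hlα : Real.log 2 ≤ Real.log α := Real.log_le_log two_pos hα'
  have ht2 : t ≤ 2 * α := by
    rw [le_div_iff₀ (by linarith)] at ht'
    nlinarith
  set ε : ℝ := 1 / (4 * t) with hε
  have hε0 : 0 < ε := by positivity
  have hε4 : ε ≤ 1 / 4 := by
    rw [hε]
    gcongr
    linarith
  obtain ⟨K, hK, hK'⟩ := exists_pow_ge Δ (g := 1 + ε) (by linarith)
  -- Growth by `1 + ε` thus needs only `O(t * log Δ)` deterministic iterations.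
  have hlogε : 1 / (5 * t) ≤ Real.log (1 + ε) := by
    refine le_trans ?_ (Real.one_sub_inv_le_log_of_pos (by linarith))
    have : 1 - (1 + ε)⁻¹ = 1 / (4 * t + 1) := by
      rw [hε]
      field_simp
      ring
    rw [this]
    gcongr
    linarith
  have hK10 : (K : ℝ) ≤ 1 + 10 * (t * Real.log (max (Δ : ℝ) 2)) := by
    refine hK'.trans ?_
    gcongr
    rw [div_le_iff₀ (lt_of_lt_of_le (by positivity) hlogε)]
    calc 2 * Real.log (max (Δ : ℝ) 2)
        = 10 * (t * Real.log (max (Δ : ℝ) 2)) * (1 / (5 * t)) := by field_simp; norm_num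
      _ ≤ _ := by gcongr
  obtain ⟨γ, J, M, hγ, hJ, hM, hMJ, hcost⟩ :=
    -- Here `y = 1 / l` is the growth still missing after the deterministic stage.
    exists_samplingStage_params hα Δ ht ht' (y := 4 * t * (α + 1)) (by nlinarith) (by
      have h1 : 4 * t * (α + 1) ≤ 4 * (2 * α) * (α + α) := by gcongr; linarith
      have h2 : (16 : ℝ) ≤ (α : ℝ) ^ 4 := by
        have := pow_le_pow_left₀ (by norm_num) hα' 4
        norm_num at this
        exact this
      calc 4 * t * (α + 1) ≤ 16 * (α : ℝ) ^ 2 := by linarith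
        _ ≤ (α : ℝ) ^ 4 * (α : ℝ) ^ 2 := by gcongr
        _ = (α : ℝ) ^ 6 := by ring)
  have happ := approximatesMDS_primalDualAlgorithm (α := α) (l := ε / (α + 1)) hε0.le hε4 hγ
    (by field_simp) hK hJ (by
      rw [hε, div_div, one_div_mul_eq_div, one_lt_div (by positivity)]
      exact hM)
  refine ⟨primalDualAlgorithm (ε / (α + 1) / (1 + ε) ^ K) (dominatingSetSchedule ε γ Δ K J M),
    ?_, fun V _ N c hc hN hΔ => ?_⟩
  · change ((2 + 3 * (dominatingSetSchedule ε γ Δ K J M).length : ℕ) : ℝ) ≤ _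
    rw [length_dominatingSetSchedule]
    push_cast
    nlinarith
  · obtain ⟨h1, h2, h3⟩ := happ V N c hc hN hΔ
    refine ⟨h1, h2, h3.trans (mul_le_mul_of_nonneg_right ?_ (Nat.cast_nonneg _))⟩
    have h4 : (α : ℝ) * (1 + 4 * ε) = α + α / t := by
      rw [hε]
      field_simp
    have h5 : 0 ≤ (α : ℝ) / t := by positivity
    nlinarith

end schedule

/-- The constant `C` is absolute and `B c` depends only on the exponent `c` in the polynomial bound
on weights and identifiers. The program depends only on `α`, `Δ` and `t`. -/
theorem theorem2 :
    ∃ (C : ℝ) (B : ℕ → ℝ),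
      (∀ (α Δ : ℕ) (t : ℝ), 2 ≤ α → 1 ≤ t → t ≤ (α : ℝ) / Real.log (α : ℝ) →
        ∃ A : DistributedAlgorithm,
          (A.rounds : ℝ) ≤ C * (t * Real.log (max (Δ : ℝ) 2)) ∧
          A.ApproximatesMDS B α Δ ((α : ℝ) + C * ((α : ℝ) / t))) ∧
      (∀ (α Δ : ℕ), 2 ≤ α →
        ∃ A : DistributedAlgorithm,
          (A.rounds : ℝ) ≤ C * ((α : ℝ) * Real.log (max (Δ : ℝ) 2)) ∧
          A.ApproximatesMDS B α Δ ((α : ℝ) + C * Real.log (α : ℝ))) := by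
  -- The constant is `2 * 712`: the second claim uses `t = α / log α`, which is at most `2 * α`.
  refine ⟨1424, fun c => 2 * (c + 2), fun α Δ t hα ht ht' => ?_, fun α Δ hα => ?_⟩
  · obtain ⟨A, hA, hA'⟩ := exists_approximatesMDS hα Δ ht ht' (C := 1424) (by norm_num)
    refine ⟨A, hA.trans ?_, hA'⟩
    have := half_le_log_max Δ
    gcongr
    norm_num
  · have hα' : (2 : ℝ) ≤ α := by exact_mod_cast hα
    have hlog2 := Real.log_two_gt_d9
    have hlα : Real.log 2 ≤ Real.log α := Real.log_le_log two_pos hα'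
    have hlog : 0 < Real.log (α : ℝ) := by linarith
    have ht : 1 ≤ (α : ℝ) / Real.log α := by
      rw [one_le_div hlog]
      have := Real.log_le_sub_one_of_pos (show (0 : ℝ) < α by linarith)
      linarith
    obtain ⟨A, hA, hA'⟩ := exists_approximatesMDS hα Δ ht le_rfl (C := 1424) (by norm_num)
    rw [div_div_cancel₀ (by linarith)] at hA'
    refine ⟨A, hA.trans ?_, hA'⟩
    have hL := half_le_log_max Δ
    have h2 : (α : ℝ) / Real.log α ≤ 2 * α := by
      rw [div_le_iff₀ hlog]
      nlinarith
    calc _ ≤ 712 * (2 * α * Real.log (max (Δ : ℝ) 2)) := by gcongr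
      _ = _ := by ring
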